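/- Let $L\ge 1$ and $p\ge 1$ be integers and let $\varrho,\alpha,D,\mu,\kappa>0$. Let $h_1,\dots,h_L$ be independent random variables, each with the $\kappa$-$\mu$ density $$f_h(x)=A\,x^{\mu}e^{-Bx^2}I_{\mu-1}(Mx),\quad x>0,\qquad A=\frac{2\mu(1+\kappa)^{\frac{\mu+1}{2}}}{\kappa^{\frac{\mu-1}{2}}e^{\mu\kappa}},\quad B=\mu(1+\kappa),\quad M=2\mu\sqrt{\kappa(1+\kappa)},$$ where $I_\nu$ is the modified Bessel function of the first kind. Let $q$ be independent of $(h_1,\dots,h_L)$ with the three-dimensional random-waypoint density $$f_q(x)=\sum_{i=1}^{3}\frac{C_i}{D^{\beta_i+1}}x^{\beta_i},\quad 0\le x\le D,\qquad (C_1,C_2,C_3)=\tfrac1{72}(735,-1190,455),\quad (\beta_1,\beta_2,\beta_3)=(2,4,6).$$ For an average SNR $\bar\gamma>0$ let $\gamma_{\rm out}=\sum_{l=1}^{L}\varrho\,|h_l|^2q^{-\alpha}\bar\gamma$ be the SNR at the output of the $L$-branch maximal ratio combiner, with CDF $F(\gamma)=\Pr(\gamma_{\rm out}\le\gamma)$.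 For $1\le i\le 3$ and $0\le k\le p$ put $$\Psi_i=\frac{\beta_i+1}{\alpha},\qquad V(k,p,v)=\frac{\Gamma(p+k)\,p^{1-2k}}{\Gamma(k+1)\Gamma(p-k+1)\Gamma(v+k+1)},$$ $$K_1=K_1(i,k)=\frac{C_i\,V(k,p,L\mu-1)\,(L\mu\kappa)^{k}}{\alpha\,e^{L\mu\kappa}},\qquad K_2=K_2(\bar\gamma)=\frac{L\mu(1+\kappa)D^{\alpha}}{\varrho L\bar\gamma},$$ $$G_{i,k}(z)=\mathrm{G}^{1,2}_{2,3}\!\left[z\,\middle|\,\begin{matrix}1-\Psi_i,\ 1\\ L\mu+k,\ 0,\ -\Psi_i\end{matrix}\right],\qquad R_{i,k}=\frac{\Gamma(\Psi_i+L\mu+k)\,\Gamma(L\mu+k)}{\Gamma(1+L\mu+k)\,\Gamma(1+\Psi_i+L\mu+k)},$$ where $\mathrm G$ is the Meijer G-function, and define $$F^{\infty}(\gamma)=\sum_{i=1}^{3}\sum_{k=0}^{p}K_1\,(K_2\gamma)^{L\mu+k}\,R_{i,k}.$$ Then $F^\infty$ is the asymptotic CDF of $\gamma_{\rm out}$ at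 high SNR, in the following sense. 1. For every fixed $\gamma>0$, $F(\gamma)\sim F^{\infty}(\gamma)$ as $\bar\gamma\to\infty$. 2. For every fixed $\gamma>0$, the Meijer G expression for the CDF has the same asymptotics: $\sum_{i=1}^{3}\sum_{k=0}^{p}K_1\,G_{i,k}(K_2\gamma)\sim F^{\infty}(\gamma)$ as $\bar\gamma\to\infty$. 3. Each power term of $F^\infty$ is the leading term of the corresponding Meijer G-function: for all $1\le i\le 3$ and $0\le k\le p$, $G_{i,k}(z)\sim R_{i,k}\,z^{L\mu+k}$ as $z\to0^+$ (here $z=K_2\gamma$). Here $f\sim g$ means that the ratio $f/g$ tends to $1$. -/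

import Mathlib

open Filter Topology Asymptotics MeasureTheory ProbabilityTheory

namespace RFLink

noncomputable section

/-! ### Special functions -/

/-- The modified Bessel function of the first kind `I_ν(x)`, for real order `ν` and `x > 0`. -/
def besselI (ν x : ℝ) : ℝ :=
  ∑' n : ℕ, (x / 2) ^ (ν + 2 * (n : ℝ)) / (Real.Gamma ((n : ℝ) + 1) * Real.Gamma (ν + n + 1))

/-- The integrand (without the power `z ^ s`) in the Mellin-Barnes integral of the Meijer G-function
`G^{m,n}_{p,q}[z | a, a'; b, b']`, with `a = (a_1, …, a_n)`, `a' = (a_{n+1}, …, a_p)`,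
`b = (b_1, …, b_m)` and `b' = (b_{m+1}, …, b_q)`. -/
def meijerKernel {m n p' q' : ℕ} (a : Fin n → ℝ) (a' : Fin p' → ℝ) (b : Fin m → ℝ)
    (b' : Fin q' → ℝ) (s : ℂ) : ℂ :=
  ((∏ i, Complex.Gamma ((b i : ℂ) - s)) * ∏ i, Complex.Gamma (1 - (a i : ℂ) + s)) /
    ((∏ i, Complex.Gamma (1 - (b' i : ℂ) + s)) * ∏ i, Complex.Gamma ((a' i : ℂ) - s))

/-- The vertical line `Re s = c` separates the poles of `Γ(b_i - s)` (which lie to the right) from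
the poles of `Γ(1 - a_i + s)` (which lie to the left). -/
def Separates {m n : ℕ} (a : Fin n → ℝ) (b : Fin m → ℝ) (c : ℝ) : Prop :=
  (∀ i, a i - 1 < c) ∧ ∀ i, c < b i

open Classical in
/-- The Meijer G-function at `z > 0`: the integral `(2πi)⁻¹ ∫ kernel(s) z ^ s ds` along an upward
vertical line that separates the two families of poles, in the case where there is such a line
(by Cauchy's theorem it does not matter which one is taken); the value is `0` otherwise. -/
def meijerG {m n p' q' : ℕ} (a : Fin n → ℝ) (a' : Fin p' → ℝ) (b : Fin m → ℝ)
    (b' : Fin q' → ℝ) (z : ℝ) : ℂ :=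
  if h : ∃ c : ℝ, Separates a b c then
    (1 / (2 * (Real.pi : ℂ))) * ∫ y : ℝ,
      meijerKernel a a' b b' ((h.choose : ℂ) + y * Complex.I) *
        (z : ℂ) ^ ((h.choose : ℂ) + y * Complex.I)
  else 0

/-! ### The channel model -/

/-- `B = μ (1 + κ)`. -/
def kmB (μ κ : ℝ) : ℝ := μ * (1 + κ)

/-- `A = 2 μ (1 + κ)^((μ+1)/2) / (κ^((μ-1)/2) e^(μ κ))`. -/
def kmA (μ κ : ℝ) : ℝ :=
  2 * μ * (1 + κ) ^ ((μ + 1) / 2) / (κ ^ ((μ - 1) / 2) * Real.exp (μ * κ))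

/-- `M = 2 μ √(κ (1 + κ))`. -/
def kmM (μ κ : ℝ) : ℝ := 2 * μ * Real.sqrt (κ * (1 + κ))

/-- The `κ-μ` density `A x^μ exp(-B x²) I_{μ-1}(M x)` on `(0, ∞)`. -/
def kappaMuPDF (μ κ : ℝ) : ℝ → ℝ :=
  (Set.Ioi (0 : ℝ)).indicator fun x =>
    kmA μ κ * x ^ μ * Real.exp (-(kmB μ κ * x ^ 2)) * besselI (μ - 1) (kmM μ κ * x)

/-- The coefficients `C = (735, -1190, 455) / 72` of the 3D random waypoint model. -/
def rwpC : Fin 3 → ℝ := ![735 / 72, -1190 / 72, 455 / 72]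

/-- The exponents `β = (2, 4, 6)` of the 3D random waypoint model. -/
def rwpβ : Fin 3 → ℝ := ![2, 4, 6]

/-- The density of the distance in the 3D random waypoint model with radius `D`. -/
def rwpPDF (D : ℝ) : ℝ → ℝ :=
  (Set.Icc (0 : ℝ) D).indicator fun x => ∑ i, rwpC i / D ^ (rwpβ i + 1) * x ^ rwpβ i

/-- The SNR `∑_l ϱ |h_l|² q^(-α) γbar` at the output of the `L`-branch maximal ratio combiner. -/
def snr {Ω : Type*} {L : ℕ} (ρ α : ℝ) (h : Fin L → Ω → ℝ) (q : Ω → ℝ) (γbar : ℝ) (ω : Ω) : ℝ :=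
  ∑ l, ρ * |h l ω| ^ 2 * q ω ^ (-α) * γbar

/-! ### The constants and the asymptotic CDF -/

/-- `V(k, p, v) = Γ(p+k) p^(1-2k) / (Γ(k+1) Γ(p-k+1) Γ(v+k+1))`. -/
def V (k p : ℕ) (v : ℝ) : ℝ :=
  Real.Gamma ((p : ℝ) + k) * (p : ℝ) ^ (1 - 2 * (k : ℤ)) /
    (Real.Gamma ((k : ℝ) + 1) * Real.Gamma ((p : ℝ) - k + 1) * Real.Gamma (v + k + 1))

/-- `Ψ_i = (β_i + 1) / α`. -/
def Ψ (α : ℝ) (i : Fin 3) : ℝ := 1 / α * (rwpβ i + 1)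

/-- `K₁ = C_i V(k, p, Lμ - 1) (Lμκ)^k / (α e^(Lμκ))`. -/
def K₁ (α μ κ : ℝ) (L p : ℕ) (i : Fin 3) (k : ℕ) : ℝ :=
  1 / (α * Real.exp (L * μ * κ)) * rwpC i * V k p (L * μ - 1) * (L * μ * κ) ^ k

/-- `K₂ = B D^α / (ϱ L γbar)`, where `B` is formed with the parameter `Lμ` of the combined link. -/
def K₂ (ρ α D μ κ : ℝ) (L : ℕ) (γbar : ℝ) : ℝ :=
  kmB (L * μ) κ * D ^ α / (ρ * L * γbar)

/-- The function `G^{1,2}_{2,3}[z | 1 - Ψ_i, 1; Lμ + k, 0, -Ψ_i]`. -/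
def termG (α μ : ℝ) (L : ℕ) (i : Fin 3) (k : ℕ) (z : ℝ) : ℂ :=
  meijerG ![1 - Ψ α i, 1] ![] ![L * μ + k] ![0, -Ψ α i] z

/-- The expression `∑_i ∑_{k ≤ p} K₁ G^{1,2}_{2,3}[K₂ γ | …]` for the CDF of the SNR. -/
def cdfG (ρ α D μ κ : ℝ) (L p : ℕ) (γbar γ : ℝ) : ℂ :=
  ∑ i : Fin 3, ∑ k ∈ Finset.range (p + 1),
    (K₁ α μ κ L p i k : ℂ) * termG α μ L i k (K₂ ρ α D μ κ L γbar * γ)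

/-- `T₁ = (Ψ_i, 0)`. -/
def T₁ (α : ℝ) (i : Fin 3) : Fin 2 → ℝ := ![Ψ α i, 0]

/-- `T₂ = (1, 1 + Ψ_i)`. -/
def T₂ (α : ℝ) (i : Fin 3) : Fin 2 → ℝ := ![1, 1 + Ψ α i]

/-- The ratio of Gamma functions `∏ Γ(T₁ + Lμ + k) / ∏ Γ(T₂ + Lμ + k)`. -/
def gammaRatio (α μ : ℝ) (L : ℕ) (i : Fin 3) (k : ℕ) : ℝ :=
  (∏ l, Real.Gamma (T₁ α i l + L * μ + k)) / ∏ l, Real.Gamma (T₂ α i l + L * μ + k)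

/-- The asymptotic CDF `∑_i ∑_{k ≤ p} K₁ (K₂ γ)^(Lμ+k) ∏ Γ(T₁ + Lμ + k) / ∏ Γ(T₂ + Lμ + k)`. -/
def cdfInf (ρ α D μ κ : ℝ) (L p : ℕ) (γbar γ : ℝ) : ℝ :=
  ∑ i : Fin 3, ∑ k ∈ Finset.range (p + 1),
    K₁ α μ κ L p i k * (K₂ ρ α D μ κ L γbar * γ) ^ (L * μ + k) * gammaRatio α μ L i k

end

end RFLink

/-! The three functions of the average SNR are compared through one power, `(K₂ γ) ^ (Lμ)`. Terms
with `k ≥ 1` are smaller by a factor `(K₂ γ) ^ k`, so only `k = 0` counts, and all three ratios tend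
to `leadingCoeff`.

For the true CDF, each `κ-μ` density is `x ^ (2μ - 1)` times a factor with a limit at the origin.
Adding one square at a time, with a beta integral at each step, gives `P(∑ h_l² ≤ y) ~ c y ^ (Lμ)`
(`tendsto_real_add_sq_le_div`, `tendsto_real_sum_sq_le_div`). Conditioning on `q` multiplies `c` by
the moment `E[q ^ (αLμ)]` (`tendsto_real_mul_rpow_le_div`). The result is `leadingCoeff` because the
`k = 0` coefficient `V` does not depend on `p` (`leadingCoeff_eq`). Although one `C_i` is negative,
the moment is positive, so the ratios may be divided.

For the Meijer function no residues are needed: its kernel is `Γ(b - s) / (s (s + ψ))`, a product of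
two Mellin transforms. Fubini and Mellin inversion give `G(z) = z ^ b ∫ exp(-z u) u ^ (b - 1)
truncKernel ψ u du`, and dominated convergence as `z → 0` yields `1 / (b (b + ψ))`, which is the
Gamma ratio. -/

namespace RFLink

/-! ### The Meijer G-function as a Mellin convolution -/

/-- The truncated power kernel `(1 - min(x, 1) ^ ψ) / ψ`, whose Mellin transform is
`1 / (s (s + ψ))`. -/
noncomputable def truncKernel (ψ x : ℝ) : ℝ := (1 - min x 1 ^ ψ) / ψ

lemma continuous_truncKernel {ψ : ℝ} (hψ : 0 < ψ) : Continuous (truncKernel ψ) := by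
  unfold truncKernel
  refine (continuous_const.sub ?_).div_const _
  exact (continuous_id.min continuous_const).rpow_const fun _ => Or.inr hψ.le

lemma truncKernel_nonneg {ψ x : ℝ} (hψ : 0 < ψ) (hx : 0 < x) : 0 ≤ truncKernel ψ x := by
  have h : min x 1 ^ ψ ≤ 1 :=
    Real.rpow_le_one (le_min hx.le zero_le_one) (min_le_right _ _) hψ.le
  exact div_nonneg (by linarith) hψ.le

/-- Partial fractions: `1/s` and `1/(s + ψ)` are the transforms of `1` and `x ^ ψ` cut off to `(0,
1]`, and the kernel vanishes beyond `1`. -/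
lemma hasMellin_truncKernel {ψ : ℝ} (hψ : 0 < ψ) {s : ℂ} (hs : 0 < s.re) :
    HasMellin (fun x => (truncKernel ψ x : ℂ)) s (1 / (s * (s + ψ))) := by
  have h1 := hasMellin_one_Ioc hs
  have h2 := hasMellin_cpow_Ioc (ψ : ℂ) (s := s) (by simpa using by positivity)
  have h3 := hasMellin_const_smul (hasMellin_sub h1.1 h2.1).1 ((ψ : ℂ)⁻¹)
  have hs0 : s ≠ 0 := by rintro rfl; simp at hs
  have hsψ : s + ψ ≠ 0 := by
    intro h
    have := congrArg Complex.re h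
    simp at this
    linarith
  have hψ0 : (ψ : ℂ) ≠ 0 := by exact_mod_cast hψ.ne'
  have hfun : ∀ t ∈ Set.Ioi (0 : ℝ), (ψ : ℂ)⁻¹ • ((Set.Ioc (0 : ℝ) 1).indicator (fun _ => (1 : ℂ)) t
      - (Set.Ioc (0 : ℝ) 1).indicator (fun t : ℝ => (t : ℂ) ^ (ψ : ℂ)) t)
      = (truncKernel ψ t : ℂ) := by
    intro t ht
    have ht0 : (0 : ℝ) < t := ht
    unfold truncKernel
    by_cases h : t ≤ 1
    · have hmem : t ∈ Set.Ioc (0 : ℝ) 1 := ⟨ht0, h⟩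
      rw [Set.indicator_of_mem hmem, Set.indicator_of_mem hmem, min_eq_left h,
        ← Complex.ofReal_cpow ht0.le]
      push_cast
      rw [smul_eq_mul]
      field_simp
    · rw [Set.indicator_of_notMem (by simp [h]), Set.indicator_of_notMem (by simp [h]),
        min_eq_right (not_le.1 h).le]
      simp
  refine ⟨?_, ?_⟩
  · refine (integrableOn_congr_fun (fun t ht => ?_) measurableSet_Ioi).1 h3.1
    simp only
    rw [← hfun t ht]
  · have h4 := h3.2
    rw [(hasMellin_sub h1.1 h2.1).2, h1.2, h2.2] at h4
    have h5 : mellin (fun x => (truncKernel ψ x : ℂ)) s = (ψ : ℂ)⁻¹ • (1 / s - 1 / (s + ψ)) := by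
      rw [← h4]
      refine setIntegral_congr_fun measurableSet_Ioi fun t ht => ?_
      simp only
      rw [← hfun t ht]
    rw [h5, smul_eq_mul]
    field_simp
    ring

lemma integrableOn_truncKernel {ψ b : ℝ} (hψ : 0 < ψ) (hb : 0 < b) :
    IntegrableOn (fun t => t ^ (b - 1) * truncKernel ψ t) (Set.Ioi 0) ∧
      ∫ t in Set.Ioi (0 : ℝ), t ^ (b - 1) * truncKernel ψ t = 1 / (b * (b + ψ)) := by
  have h := hasMellin_truncKernel hψ (s := (b : ℂ)) (by simpa using hb)
  have hfun : ∀ t ∈ Set.Ioi (0 : ℝ), (t : ℂ) ^ ((b : ℂ) - 1) • (truncKernel ψ t : ℂ) =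
      ((t ^ (b - 1) * truncKernel ψ t : ℝ) : ℂ) := by
    intro t ht
    rw [smul_eq_mul, Complex.ofReal_mul, Complex.ofReal_cpow (le_of_lt ht)]
    push_cast
    rfl
  refine ⟨?_, ?_⟩
  · have h1 := ((integrableOn_congr_fun hfun measurableSet_Ioi).1 h.1).re
    simpa [IntegrableOn] using h1
  · have h2 := h.2
    rw [mellin, setIntegral_congr_fun measurableSet_Ioi hfun, integral_complex_ofReal] at h2
    exact_mod_cast h2

lemma line_ne_zero {c : ℝ} (hc : 0 < c) (y : ℝ) : (c : ℂ) + y * Complex.I ≠ 0 := by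
  intro h
  have := congrArg Complex.re h
  simp at this
  linarith

/-- Quadratic decay, with majorant `1 / (c² + y²)`. It serves both Mellin inversion and Fubini, so
no decay estimate for `Γ` on vertical lines is required. -/
lemma verticalIntegrable_rational {ψ c : ℝ} (hψ : 0 < ψ) (hc : 0 < c) :
    Integrable fun y : ℝ => 1 / (((c : ℂ) + y * Complex.I) * ((c : ℂ) + y * Complex.I + ψ)) := by
  have hline : ∀ y : ℝ, (c : ℂ) + y * Complex.I + ψ = ((c + ψ : ℝ) : ℂ) + y * Complex.I := by
    intro y; push_cast; ring
  have hbd : Integrable fun y : ℝ => (c ^ 2)⁻¹ * (1 + (c⁻¹ * y) ^ 2)⁻¹ :=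
    (integrable_inv_one_add_sq.comp_mul_left' (inv_ne_zero hc.ne')).const_mul _
  refine hbd.mono' ?_ (Eventually.of_forall fun y => ?_)
  · refine Continuous.aestronglyMeasurable ?_
    refine continuous_const.div (by fun_prop) fun y => ?_
    rw [hline]
    exact mul_ne_zero (line_ne_zero hc y) (line_ne_zero (by positivity) y)
  · have hn : ∀ d : ℝ, ‖(d : ℂ) + y * Complex.I‖ = Real.sqrt (d ^ 2 + y ^ 2) := fun d => by
      rw [Complex.norm_add_mul_I]
    rw [hline, norm_div, norm_mul, hn, hn, norm_one]
    have hle : Real.sqrt (c ^ 2 + y ^ 2) ≤ Real.sqrt ((c + ψ) ^ 2 + y ^ 2) :=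
      Real.sqrt_le_sqrt (by nlinarith [mul_pos hc hψ])
    have hpos : 0 < c ^ 2 + y ^ 2 := by positivity
    calc 1 / (Real.sqrt (c ^ 2 + y ^ 2) * Real.sqrt ((c + ψ) ^ 2 + y ^ 2))
        ≤ 1 / (Real.sqrt (c ^ 2 + y ^ 2) * Real.sqrt (c ^ 2 + y ^ 2)) := by
          have := Real.sqrt_pos.2 hpos
          gcongr
      _ = (c ^ 2)⁻¹ * (1 + (c⁻¹ * y) ^ 2)⁻¹ := by
          rw [Real.mul_self_sqrt hpos.le]
          field_simp

/-- Mellin inversion for the truncated power kernel. -/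
lemma integral_line_rational {ψ c x : ℝ} (hψ : 0 < ψ) (hc : 0 < c) (hx : 0 < x) :
    (1 / (2 * (Real.pi : ℂ))) * ∫ y : ℝ, (x : ℂ) ^ (-((c : ℂ) + y * Complex.I)) *
      (1 / (((c : ℂ) + y * Complex.I) * ((c : ℂ) + y * Complex.I + ψ))) = truncKernel ψ x := by
  have hm : ∀ y : ℝ, mellin (fun x => (truncKernel ψ x : ℂ)) ((c : ℂ) + y * Complex.I) =
      1 / (((c : ℂ) + y * Complex.I) * ((c : ℂ) + y * Complex.I + ψ)) := fun y =>
    (hasMellin_truncKernel hψ (by simpa using hc)).2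
  have h := mellinInv_mellin_eq c (fun x => (truncKernel ψ x : ℂ)) hx
    (hasMellin_truncKernel hψ (by simpa using hc)).1 ?_ ?_
  · rw [← h, mellinInv]
    simp only [hm, smul_eq_mul]
    rw [Complex.real_smul]
    push_cast
    rfl
  · unfold Complex.VerticalIntegrable
    simp only [hm]
    exact verticalIntegrable_rational hψ hc
  · exact (Complex.continuous_ofReal.comp (continuous_truncKernel hψ)).continuousAt

/-- Expand `Γ(b - s)` as Euler's integral, legitimate since `c < b`, and swap: the inner line
integral is Mellin inversion at `t / z`. -/
lemma integral_line_gamma {ψ b c z : ℝ} (hψ : 0 < ψ) (hc : 0 < c) (hcb : c < b) (hz : 0 < z) :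
    (1 / (2 * (Real.pi : ℂ))) * ∫ y : ℝ, Complex.Gamma ((b : ℂ) - ((c : ℂ) + y * Complex.I)) *
      (1 / (((c : ℂ) + y * Complex.I) * ((c : ℂ) + y * Complex.I + ψ))) *
        (z : ℂ) ^ ((c : ℂ) + y * Complex.I) =
    ((∫ t in Set.Ioi (0 : ℝ), Real.exp (-t) * t ^ (b - 1) * truncKernel ψ (t / z) : ℝ) : ℂ) := by
  set r : ℝ → ℂ := fun y =>
    1 / (((c : ℂ) + y * Complex.I) * ((c : ℂ) + y * Complex.I + ψ)) with hr
  have hrint : Integrable r := verticalIntegrable_rational hψ hc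
  set f : ℝ → ℝ → ℂ := fun y t => ((Real.exp (-t) : ℝ) : ℂ) *
    (t : ℂ) ^ ((b : ℂ) - ((c : ℂ) + y * Complex.I) - 1) *
      (r y * (z : ℂ) ^ ((c : ℂ) + y * Complex.I)) with hf
  have hint : Integrable (Function.uncurry f) (volume.prod (volume.restrict (Set.Ioi 0))) := by
    -- On the line `|z ^ s| = z ^ c` and `|t ^ (b - s - 1)| = t ^ (b - c - 1)` do not depend on `y`,
    -- so the majorant is a product.
    have hb := (hrint.norm.const_mul (z ^ c)).mul_prod
      (Real.GammaIntegral_convergent (s := b - c) (by linarith))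
    refine hb.mono' ?_ ?_
    · refine AEStronglyMeasurable.mul (Measurable.aestronglyMeasurable ?_) ?_
      · fun_prop
      · refine AEStronglyMeasurable.mul hrint.aestronglyMeasurable.comp_fst ?_
        exact Measurable.aestronglyMeasurable (by fun_prop)
    · rw [← Measure.restrict_univ (μ := (volume : Measure ℝ)), Measure.restrict_restrict
        measurableSet_Ioi, Measure.prod_restrict]
      refine (ae_restrict_iff' (by measurability)).2 (Eventually.of_forall ?_)
      rintro ⟨y, t⟩ ht
      have ht0 : 0 < t := by simpa using ht
      simp only [Function.uncurry, hf, norm_mul]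
      rw [Complex.norm_cpow_eq_rpow_re_of_pos ht0, Complex.norm_cpow_eq_rpow_re_of_pos hz,
        Complex.norm_real, Real.norm_of_nonneg (Real.exp_pos _).le]
      simp
      apply le_of_eq; ring
  have hswap := integral_integral_swap hint
  have hleft : ∀ y, ∫ t in Set.Ioi (0 : ℝ), f y t =
      Complex.Gamma ((b : ℂ) - ((c : ℂ) + y * Complex.I)) * r y *
        (z : ℂ) ^ ((c : ℂ) + y * Complex.I) := by
    intro y
    rw [Complex.Gamma_eq_integral (by simpa using hcb), Complex.GammaIntegral, mul_assoc,
      ← integral_mul_const]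
  have hright : ∀ t ∈ Set.Ioi (0 : ℝ), (1 / (2 * (Real.pi : ℂ))) * ∫ y, f y t =
      ((Real.exp (-t) * t ^ (b - 1) * truncKernel ψ (t / z) : ℝ) : ℂ) := by
    intro t ht
    have ht0 : 0 < t := ht
    have htc : (t : ℂ) ≠ 0 := by exact_mod_cast ht0.ne'
    rw [Complex.ofReal_mul, ← integral_line_rational hψ hc (div_pos ht0 hz), mul_left_comm]
    congr 1
    rw [← integral_const_mul]
    refine integral_congr_ae (Eventually.of_forall fun y => ?_)
    simp only [hf, hr]
    have hdiv : ((t / z : ℝ) : ℂ) ^ ((c : ℂ) + y * Complex.I) =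
        (t : ℂ) ^ ((c : ℂ) + y * Complex.I) / (z : ℂ) ^ ((c : ℂ) + y * Complex.I) := by
      rw [eq_div_iff (by simp [Complex.cpow_eq_zero_iff, hz.ne']),
        ← Complex.mul_cpow_ofReal_nonneg (div_pos ht0 hz).le hz.le, ← Complex.ofReal_mul,
        div_mul_cancel₀ _ hz.ne']
    rw [Complex.cpow_neg, hdiv, sub_right_comm, Complex.cpow_sub _ _ htc,
      Complex.ofReal_mul, Complex.ofReal_cpow ht0.le]
    push_cast
    rw [inv_div]
    ring
  rw [show (∫ y : ℝ, Complex.Gamma ((b : ℂ) - ((c : ℂ) + y * Complex.I)) *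
      (1 / (((c : ℂ) + y * Complex.I) * ((c : ℂ) + y * Complex.I + ψ))) *
        (z : ℂ) ^ ((c : ℂ) + y * Complex.I)) = ∫ y, ∫ t in Set.Ioi (0 : ℝ), f y t from
      integral_congr_ae (Eventually.of_forall fun y => (hleft y).symm), hswap,
    ← integral_const_mul, setIntegral_congr_fun measurableSet_Ioi hright,
    integral_complex_ofReal]

/-- The Gamma factors pair up as `Γ(w) / Γ(w + 1) = 1 / w` at `w = s` and `w = s + ψ`. -/
lemma meijerKernel_eq {ψ b : ℝ} {s : ℂ} (hψ : 0 < ψ) (hs : 0 < s.re) :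
    meijerKernel ![1 - ψ, 1] ![] ![b] ![0, -ψ] s =
      Complex.Gamma ((b : ℂ) - s) * (1 / (s * (s + ψ))) := by
  have hs0 : s ≠ 0 := by rintro rfl; simp at hs
  have hsψre : 0 < (s + ψ).re := by simpa using by positivity
  have hsψ : s + ψ ≠ 0 := by intro h; rw [h] at hsψre; simp at hsψre
  have g1 := Complex.Gamma_ne_zero_of_re_pos hs
  have g2 := Complex.Gamma_ne_zero_of_re_pos hsψre
  have e1 : (1 : ℂ) - ((1 - ψ : ℝ) : ℂ) + s = s + ψ := by push_cast; ring
  have e2 : (1 : ℂ) - ((-ψ : ℝ) : ℂ) + s = (s + ψ) + 1 := by push_cast; ring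
  have e3 : (1 : ℂ) - ((0 : ℝ) : ℂ) + s = s + 1 := by push_cast; ring
  have e4 : (1 : ℂ) - ((1 : ℝ) : ℂ) + s = s := by push_cast; ring
  simp only [meijerKernel, Fin.prod_univ_two, Finset.univ_unique, Finset.prod_singleton,
    Matrix.cons_val_zero, Matrix.cons_val_one, Matrix.cons_val_fin_one,
    Finset.univ_eq_empty, Finset.prod_empty, mul_one, e1, e2, e3, e4]
  rw [Complex.Gamma_add_one _ hs0, Complex.Gamma_add_one _ hsψ]
  field_simp

/-- The Meijer G-function `G^{1,2}_{2,3}[z | 1 - ψ, 1; b, 0, -ψ]` as a real integral. -/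
lemma meijerG_eq_integral {ψ b z : ℝ} (hψ : 0 < ψ) (hb : 0 < b) (hz : 0 < z) :
    meijerG ![1 - ψ, 1] ![] ![b] ![0, -ψ] z =
      ((∫ t in Set.Ioi (0 : ℝ), Real.exp (-t) * t ^ (b - 1) * truncKernel ψ (t / z) : ℝ) : ℂ) := by
  have hex : ∃ c : ℝ, Separates ![1 - ψ, 1] ![b] c := by
    refine ⟨b / 2, fun i => ?_, fun i => ?_⟩
    · fin_cases i <;> simp <;> linarith
    · fin_cases i; simp; linarith
  rw [meijerG, dif_pos hex]
  have hc : 0 < hex.choose := by simpa using hex.choose_spec.1 1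
  have hcb : hex.choose < b := by simpa using hex.choose_spec.2 0
  -- The integral is evaluated for every `c` in `(0, b)`, so which separating line was chosen is
  -- irrelevant and no contour shift is needed.
  generalize hex.choose = c at hc hcb
  rw [← integral_line_gamma hψ hc hcb hz]
  congr 2
  ext y
  rw [meijerKernel_eq hψ (by simpa using hc)]

/-- The substitution `t = z u` moves the whole singular dependence on `z` into the factor `z ^ b`.
-/
lemma integral_exp_truncKernel_eq {ψ b z : ℝ} (hz : 0 < z) :
    ∫ t in Set.Ioi (0 : ℝ), Real.exp (-t) * t ^ (b - 1) * truncKernel ψ (t / z) =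
      z ^ b * ∫ u in Set.Ioi (0 : ℝ), Real.exp (-(z * u)) * (u ^ (b - 1) * truncKernel ψ u) := by
  have h := integral_comp_mul_left_Ioi
    (fun t => Real.exp (-t) * t ^ (b - 1) * truncKernel ψ (t / z)) 0 hz
  rw [mul_zero, smul_eq_mul, eq_comm, inv_mul_eq_iff_eq_mul₀ hz.ne'] at h
  rw [h, ← integral_const_mul, ← integral_const_mul]
  refine setIntegral_congr_fun measurableSet_Ioi fun u hu => ?_
  have hu0 : 0 < u := hu
  rw [mul_div_cancel_left₀ _ hz.ne', Real.mul_rpow hz.le hu0.le]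
  have hzb : z ^ b = z * z ^ (b - 1) := by
    rw [Real.rpow_sub_one hz.ne']
    field_simp
  rw [hzb]
  ring

/-- Once `z ^ b` is removed, the integrand is dominated by its value at `z = 0`, whose integral is
the Mellin transform of the kernel at `b`. -/
lemma tendsto_meijerG_div {ψ b : ℝ} (hψ : 0 < ψ) (hb : 0 < b) :
    Tendsto (fun z : ℝ => meijerG ![1 - ψ, 1] ![] ![b] ![0, -ψ] z / ((z ^ b : ℝ) : ℂ)) (𝓝[>] 0)
      (𝓝 ((1 / (b * (b + ψ)) : ℝ) : ℂ)) := by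
  obtain ⟨hint, hval⟩ := integrableOn_truncKernel hψ hb
  have hlim : Tendsto (fun z : ℝ => ∫ u in Set.Ioi (0 : ℝ),
      Real.exp (-(z * u)) * (u ^ (b - 1) * truncKernel ψ u)) (𝓝[>] 0)
      (𝓝 (1 / (b * (b + ψ)))) := by
    rw [← hval]
    refine tendsto_integral_filter_of_dominated_convergence
      (fun u => u ^ (b - 1) * truncKernel ψ u) ?_ ?_ hint ?_
    · refine Eventually.of_forall fun z => ?_
      exact (Continuous.aestronglyMeasurable (by fun_prop)).mul hint.aestronglyMeasurable
    · filter_upwards [self_mem_nhdsWithin] with z hz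
      refine (ae_restrict_iff' measurableSet_Ioi).2 (Eventually.of_forall fun u hu => ?_)
      have hu0 : 0 < u := hu
      have hz0 : 0 < z := hz
      have hn : 0 ≤ u ^ (b - 1) * truncKernel ψ u :=
        mul_nonneg (Real.rpow_nonneg hu0.le _) (truncKernel_nonneg hψ hu0)
      rw [norm_mul, Real.norm_of_nonneg (Real.exp_pos _).le, Real.norm_of_nonneg hn]
      refine mul_le_of_le_one_left hn (Real.exp_le_one_iff.2 ?_)
      have := mul_pos hz0 hu0
      linarith
    · refine Eventually.of_forall fun u => ?_
      have h : Continuous fun z : ℝ => Real.exp (-(z * u)) * (u ^ (b - 1) * truncKernel ψ u) := by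
        fun_prop
      simpa using (h.tendsto 0).mono_left nhdsWithin_le_nhds
  refine Tendsto.congr' ?_ ((Complex.continuous_ofReal.tendsto _).comp hlim)
  filter_upwards [self_mem_nhdsWithin] with z hz
  have hz0 : 0 < z := hz
  have hzb : ((z ^ b : ℝ) : ℂ) ≠ 0 := by exact_mod_cast (Real.rpow_pos_of_pos hz0 b).ne'
  rw [meijerG_eq_integral hψ hb hz0, integral_exp_truncKernel_eq hz0, Complex.ofReal_mul,
    mul_div_cancel_left₀ _ hzb]
  rfl

lemma Ψ_pos {α : ℝ} (hα : 0 < α) (i : Fin 3) : 0 < Ψ α i := by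
  unfold Ψ rwpβ
  fin_cases i <;> simp <;> positivity

lemma gammaRatio_eq {α μ : ℝ} {L : ℕ} (hα : 0 < α) (hμ : 0 < μ) (hL : 1 ≤ L) (i : Fin 3) (k : ℕ) :
    gammaRatio α μ L i k = 1 / ((L * μ + k) * (L * μ + k + Ψ α i)) := by
  have hψ := Ψ_pos hα i
  have hL' : (0 : ℝ) < L := by exact_mod_cast hL
  have hb : (0 : ℝ) < L * μ + k := by positivity
  set b : ℝ := L * μ + k with hbdef
  have e1 : Ψ α i + L * μ + k = b + Ψ α i := by rw [hbdef]; ring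
  have e2 : (0 : ℝ) + L * μ + k = b := by rw [hbdef]; ring
  have e3 : 1 + L * μ + k = b + 1 := by rw [hbdef]; ring
  have e4 : 1 + Ψ α i + L * μ + k = b + Ψ α i + 1 := by rw [hbdef]; ring
  simp only [gammaRatio, T₁, T₂, Fin.prod_univ_two, Matrix.cons_val_zero, Matrix.cons_val_one,
    Matrix.cons_val_fin_one, e1, e2, e3, e4]
  rw [Real.Gamma_add_one hb.ne', Real.Gamma_add_one (by positivity)]
  have g1 := (Real.Gamma_pos_of_pos hb).ne'
  have g2 := (Real.Gamma_pos_of_pos (show 0 < b + Ψ α i by positivity)).ne'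
  field_simp

lemma tendsto_termG_div {α μ : ℝ} {L : ℕ} (hα : 0 < α) (hμ : 0 < μ) (hL : 1 ≤ L) (i : Fin 3)
    (k : ℕ) :
    Tendsto (fun z : ℝ => termG α μ L i k z / ((z ^ (L * μ + k) : ℝ) : ℂ)) (𝓝[>] 0)
      (𝓝 (gammaRatio α μ L i k : ℂ)) := by
  have hL' : (0 : ℝ) < L := by exact_mod_cast hL
  rw [gammaRatio_eq hα hμ hL]
  exact tendsto_meijerG_div (Ψ_pos hα i) (by positivity)

theorem termG_isEquivalent {α μ : ℝ} {L : ℕ} (hα : 0 < α) (hμ : 0 < μ) (hL : 1 ≤ L) (i : Fin 3)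
    (k : ℕ) :
    (fun z : ℝ => termG α μ L i k z) ~[𝓝[>] 0]
      fun z : ℝ => ((z ^ (L * μ + k) * gammaRatio α μ L i k : ℝ) : ℂ) := by
  have hL' : (0 : ℝ) < L := by exact_mod_cast hL
  have hg : gammaRatio α μ L i k ≠ 0 := by
    have := Ψ_pos hα i
    rw [gammaRatio_eq hα hμ hL]
    positivity
  have hgc : (gammaRatio α μ L i k : ℂ) ≠ 0 := by exact_mod_cast hg
  refine (isEquivalent_iff_tendsto_one ?_).2 ?_
  · filter_upwards [self_mem_nhdsWithin] with z hz
    exact_mod_cast mul_ne_zero (Real.rpow_pos_of_pos hz _).ne' hg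
  · have h := (tendsto_termG_div hα hμ hL i k).div_const (gammaRatio α μ L i k : ℂ)
    rw [div_self hgc] at h
    refine h.congr fun z => ?_
    simp only [Pi.div_apply]
    rw [Complex.ofReal_mul, div_div]

/-! ### The Bessel series near the origin -/

/-- The power series `∑ tⁿ / (n! Γ(ν + n + 1))`, so that `I_ν(x) = (x/2)^ν` times its value at
`(x/2)²`. -/
noncomputable def besselSeries (ν t : ℝ) : ℝ :=
  ∑' n : ℕ, t ^ n / (Real.Gamma ((n : ℝ) + 1) * Real.Gamma (ν + n + 1))

lemma summable_besselSeries {ν : ℝ} (hν : -1 < ν) (t : ℝ) :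
    Summable fun n : ℕ => t ^ n / (Real.Gamma ((n : ℝ) + 1) * Real.Gamma (ν + n + 1)) := by
  refine Summable.of_norm_bounded_eventually_nat (Real.summable_pow_div_factorial |t|) ?_
  filter_upwards [eventually_ge_atTop 2] with n hn
  have hn' : (2 : ℝ) ≤ n := by exact_mod_cast hn
  -- For `n ≥ 2` the argument exceeds `2`, where `Γ` is increasing from `Γ(2) = 1`; the exponential
  -- series then dominates.
  have h1 : 1 ≤ Real.Gamma (ν + n + 1) := by
    refine Real.Gamma_two.ge.trans ?_
    exact Real.Gamma_strictMonoOn_Ici.monotoneOn (Set.mem_Ici.2 le_rfl)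
      (Set.mem_Ici.2 (by linarith)) (by linarith)
  have hf : (0 : ℝ) < (n.factorial : ℝ) := by exact_mod_cast n.factorial_pos
  rw [Real.Gamma_nat_eq_factorial, norm_div, norm_pow, Real.norm_eq_abs, norm_mul,
    Real.norm_of_nonneg hf.le, Real.norm_of_nonneg (by linarith : 0 ≤ Real.Gamma (ν + n + 1))]
  gcongr
  exact le_mul_of_one_le_right hf.le h1

lemma measurable_besselSeries {ν : ℝ} (hν : -1 < ν) : Measurable (besselSeries ν) := by
  refine measurable_of_tendsto_metrizable (f := fun (m : ℕ) (t : ℝ) => ∑ n ∈ Finset.range m,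
    t ^ n / (Real.Gamma ((n : ℝ) + 1) * Real.Gamma (ν + n + 1))) (fun m => by fun_prop) ?_
  exact tendsto_pi_nhds.2 fun t => (summable_besselSeries hν t).hasSum.tendsto_sum_nat

lemma besselSeries_coeff_pos {ν : ℝ} (hν : -1 < ν) (n : ℕ) :
    0 < Real.Gamma ((n : ℝ) + 1) * Real.Gamma (ν + n + 1) := by
  have hn : (0 : ℝ) ≤ n := n.cast_nonneg
  exact mul_pos (Real.Gamma_pos_of_pos (by linarith)) (Real.Gamma_pos_of_pos (by linarith))

lemma besselSeries_nonneg {ν t : ℝ} (hν : -1 < ν) (ht : 0 ≤ t) : 0 ≤ besselSeries ν t :=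
  tsum_nonneg fun n => div_nonneg (pow_nonneg ht n) (besselSeries_coeff_pos hν n).le

lemma tendsto_besselSeries {ν : ℝ} (hν : -1 < ν) :
    Tendsto (besselSeries ν) (𝓝 0) (𝓝 (1 / Real.Gamma (ν + 1))) := by
  have h0 : ∑' n : ℕ, (0 : ℝ) ^ n / (Real.Gamma ((n : ℝ) + 1) * Real.Gamma (ν + n + 1)) =
      1 / Real.Gamma (ν + 1) := by
    rw [tsum_eq_single 0 fun n hn => by simp [hn]]
    simp
  rw [← h0]
  refine tendsto_tsum_of_dominated_convergence (summable_besselSeries hν 1) (fun n => ?_) ?_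
  · have h : Continuous fun t : ℝ => t ^ n / (Real.Gamma ((n : ℝ) + 1) * Real.Gamma (ν + n + 1)) := by
      fun_prop
    exact h.tendsto 0
  · filter_upwards [Metric.closedBall_mem_nhds (0 : ℝ) one_pos] with t ht n
    rw [mem_closedBall_zero_iff, Real.norm_eq_abs] at ht
    rw [norm_div, norm_pow, Real.norm_eq_abs, Real.norm_of_nonneg (besselSeries_coeff_pos hν n).le,
      one_pow]
    have := besselSeries_coeff_pos hν n
    gcongr
    exact pow_le_one₀ (abs_nonneg t) ht

lemma besselI_eq {ν x : ℝ} (hx : 0 < x) :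
    besselI ν x = (x / 2) ^ ν * besselSeries ν ((x / 2) ^ 2) := by
  rw [besselI, besselSeries, ← tsum_mul_left]
  congr 1
  ext n
  have hx2 : 0 < x / 2 := by positivity
  rw [Real.rpow_add hx2, ← pow_mul, mul_div_assoc]
  congr 2
  rw [← Real.rpow_natCast]
  push_cast
  rfl

/-- The `κ-μ` density divided by `x ^ (2μ - 1)`. -/
noncomputable def kappaMuFactor (μ κ x : ℝ) : ℝ :=
  2 * kmB μ κ ^ μ * Real.exp (-(μ * κ)) * Real.exp (-(kmB μ κ * x ^ 2)) *
    besselSeries (μ - 1) ((kmM μ κ * x / 2) ^ 2)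

lemma measurable_kappaMuFactor {μ κ : ℝ} (hμ : 0 < μ) : Measurable (kappaMuFactor μ κ) := by
  have h := measurable_besselSeries (ν := μ - 1) (by linarith)
  unfold kappaMuFactor
  fun_prop

lemma kappaMuFactor_nonneg {μ κ : ℝ} (hμ : 0 < μ) (hκ : 0 < κ) (x : ℝ) :
    0 ≤ kappaMuFactor μ κ x := by
  have h := besselSeries_nonneg (ν := μ - 1) (by linarith) (sq_nonneg (kmM μ κ * x / 2))
  have hB : 0 < kmB μ κ := by unfold kmB; positivity
  unfold kappaMuFactor
  positivity

lemma tendsto_kappaMuFactor {μ κ : ℝ} (hμ : 0 < μ) :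
    Tendsto (kappaMuFactor μ κ) (𝓝[>] 0)
      (𝓝 (2 * kmB μ κ ^ μ * Real.exp (-(μ * κ)) / Real.Gamma μ)) := by
  have h1 : Tendsto (fun x : ℝ => (kmM μ κ * x / 2) ^ 2) (𝓝[>] 0) (𝓝 0) := by
    have h : Continuous fun x : ℝ => (kmM μ κ * x / 2) ^ 2 := by fun_prop
    simpa using (h.tendsto 0).mono_left nhdsWithin_le_nhds
  have h2 : Tendsto (fun x : ℝ => Real.exp (-(kmB μ κ * x ^ 2))) (𝓝[>] 0) (𝓝 1) := by
    have h : Continuous fun x : ℝ => Real.exp (-(kmB μ κ * x ^ 2)) := by fun_prop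
    simpa using (h.tendsto 0).mono_left nhdsWithin_le_nhds
  have h3 := (tendsto_besselSeries (ν := μ - 1) (by linarith)).comp h1
  have h4 := (h2.const_mul (2 * kmB μ κ ^ μ * Real.exp (-(μ * κ)))).mul h3
  rw [sub_add_cancel, mul_one, mul_one_div] at h4
  exact h4

/-- The power `κ ^ ((μ - 1) / 2)` from `(M / 2) ^ (μ - 1)` cancels the denominator of `A`; the
powers of `μ` and `1 + κ` combine to `B ^ μ`. -/
lemma kmA_mul_kmM_rpow {μ κ : ℝ} (hμ : 0 < μ) (hκ : 0 < κ) :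
    kmA μ κ * (kmM μ κ / 2) ^ (μ - 1) = 2 * kmB μ κ ^ μ * Real.exp (-(μ * κ)) := by
  have hκ1 : 0 < 1 + κ := by positivity
  unfold kmA kmM kmB
  rw [show 2 * μ * Real.sqrt (κ * (1 + κ)) / 2 = μ * Real.sqrt (κ * (1 + κ)) by ring,
    Real.mul_rpow hμ.le (Real.sqrt_nonneg _), Real.sqrt_eq_rpow,
    ← Real.rpow_mul (by positivity), Real.mul_rpow hκ.le hκ1.le, Real.mul_rpow hμ.le hκ1.le,
    show (1 : ℝ) / 2 * (μ - 1) = (μ - 1) / 2 by ring, Real.exp_neg,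
    Real.rpow_sub_one hμ.ne']
  have h1 : (1 + κ) ^ μ = (1 + κ) ^ ((μ + 1) / 2) * (1 + κ) ^ ((μ - 1) / 2) := by
    rw [← Real.rpow_add hκ1]
    congr 1
    ring
  rw [h1]
  have h2 := (Real.rpow_pos_of_pos hκ ((μ - 1) / 2)).ne'
  field_simp

lemma kappaMuPDF_eq {μ κ : ℝ} (hμ : 0 < μ) (hκ : 0 < κ) :
    kappaMuPDF μ κ =
      (Set.Ioi (0 : ℝ)).indicator fun x => x ^ (2 * μ - 1) * kappaMuFactor μ κ x := by
  refine Set.indicator_congr fun x hx => ?_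
  have hx0 : 0 < x := hx
  have hM : 0 < kmM μ κ := by unfold kmM; positivity
  rw [besselI_eq (mul_pos hM hx0), kappaMuFactor, ← kmA_mul_kmM_rpow hμ hκ,
    show kmM μ κ * x / 2 = kmM μ κ / 2 * x by ring, Real.mul_rpow (by positivity) hx0.le,
    show 2 * μ - 1 = μ + (μ - 1) by ring, Real.rpow_add hx0]
  ring

/-! ### Beta integrals -/

lemma integral_rpow_mul_one_sub_rpow {a b : ℝ} (ha : 0 ≤ a) (hb : 0 < b) :
    ∫ t in Set.Ioo (0 : ℝ) 1, t ^ (b - 1) * (1 - t) ^ a =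
      Real.Gamma b * Real.Gamma (a + 1) / Real.Gamma (a + b + 1) := by
  have h := Complex.betaIntegral_eq_Gamma_mul_div (b : ℂ) ((a + 1 : ℝ) : ℂ) (by simpa using hb)
    (by simp; linarith)
  rw [Complex.betaIntegral, intervalIntegral.integral_of_le zero_le_one,
    integral_Ioc_eq_integral_Ioo] at h
  have hfun : ∀ t ∈ Set.Ioo (0 : ℝ) 1,
      (t : ℂ) ^ ((b : ℂ) - 1) * (1 - (t : ℂ)) ^ (((a + 1 : ℝ) : ℂ) - 1) =
        ((t ^ (b - 1) * (1 - t) ^ a : ℝ) : ℂ) := by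
    intro t ht
    rw [Complex.ofReal_mul, Complex.ofReal_cpow ht.1.le,
      Complex.ofReal_cpow (by linarith [ht.2])]
    push_cast
    rw [add_sub_cancel_right]
  rw [setIntegral_congr_fun measurableSet_Ioo hfun, integral_complex_ofReal,
    ← Complex.ofReal_add, Complex.Gamma_ofReal, Complex.Gamma_ofReal, Complex.Gamma_ofReal] at h
  rw [show a + b + 1 = b + (a + 1) by ring]
  exact_mod_cast h

lemma integral_rpow_mul_one_sub_sq_rpow {a b : ℝ} (ha : 0 ≤ a) (hb : 0 < b) :
    ∫ u in Set.Ioo (0 : ℝ) 1, u ^ (2 * b - 1) * (1 - u ^ 2) ^ a =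
      Real.Gamma b * Real.Gamma (a + 1) / Real.Gamma (a + b + 1) / 2 := by
  have h := integral_comp_rpow_Ioi_of_pos
    (g := (Set.Ioo (0 : ℝ) 1).indicator fun t => t ^ (b - 1) * (1 - t) ^ a) (p := 2) two_pos
  rw [setIntegral_indicator measurableSet_Ioo,
    Set.inter_eq_self_of_subset_right Set.Ioo_subset_Ioi_self,
    integral_rpow_mul_one_sub_rpow ha hb] at h
  have hext : ∀ g : ℝ → ℝ, ∫ u in Set.Ioo (0 : ℝ) 1, g u =
      ∫ u in Set.Ioi (0 : ℝ), (Set.Ioo (0 : ℝ) 1).indicator g u := fun g => by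
    rw [setIntegral_indicator measurableSet_Ioo,
      Set.inter_eq_self_of_subset_right Set.Ioo_subset_Ioi_self]
  rw [← h, eq_div_iff two_ne_zero, ← integral_mul_const, hext]
  refine setIntegral_congr_fun measurableSet_Ioi fun u hu => ?_
  have hu0 : 0 < u := hu
  have hiff : u ^ (2 : ℝ) ∈ Set.Ioo (0 : ℝ) 1 ↔ u ∈ Set.Ioo (0 : ℝ) 1 := by
    rw [Real.rpow_two]
    simp only [Set.mem_Ioo, hu0, pow_pos, true_and]
    exact sq_lt_one_iff₀ hu0.le
  by_cases hm : u ∈ Set.Ioo (0 : ℝ) 1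
  · rw [Set.indicator_of_mem hm, Set.indicator_of_mem (hiff.2 hm), ← Real.rpow_mul hu0.le,
      smul_eq_mul, Real.rpow_two, show 2 * b - 1 = (2 - 1) + 2 * (b - 1) by ring,
      Real.rpow_add hu0]
    ring
  · rw [Set.indicator_of_notMem hm, Set.indicator_of_notMem (fun h => hm (hiff.1 h)), smul_zero]

/-! ### Small deviations of sums of independent variables -/

variable {Ω : Type*} [MeasurableSpace Ω] {P : Measure Ω} [IsProbabilityMeasure P]

/-- Conditioning on the value of `H`: by independence the joint law is a product, and Tonelli
integrates the slices. -/
lemma real_mem_eq_integral_of_indepFun {X H : Ω → ℝ} (hX : Measurable X) (hH : Measurable H)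
    (hXH : IndepFun X H P) {f : ℝ → ℝ} (hf : Measurable f) (hf0 : ∀ x, 0 ≤ f x)
    (hlaw : P.map H = volume.withDensity fun x => ENNReal.ofReal (f x))
    {S : Set (ℝ × ℝ)} (hS : MeasurableSet S) :
    P.real {ω | (X ω, H ω) ∈ S} = ∫ x, f x * P.real {ω | (X ω, x) ∈ S} := by
  have hmap := (indepFun_iff_map_prod_eq_prod_map_map hX.aemeasurable hH.aemeasurable).1 hXH
  have : IsProbabilityMeasure (P.map X) := Measure.isProbabilityMeasure_map hX.aemeasurable
  have : IsProbabilityMeasure (P.map H) := Measure.isProbabilityMeasure_map hH.aemeasurable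
  have hslice : ∀ x, P.map X ((fun s => (s, x)) ⁻¹' S) = P {ω | (X ω, x) ∈ S} := fun x =>
    Measure.map_apply hX (measurable_prodMk_right hS)
  have hmeas : Measurable fun x => P {ω | (X ω, x) ∈ S} := by
    simp only [← hslice]
    exact measurable_measure_prodMk_right hS
  have h1 : P {ω | (X ω, H ω) ∈ S} = ∫⁻ x, ENNReal.ofReal (f x) * P {ω | (X ω, x) ∈ S} := by
    rw [show {ω | (X ω, H ω) ∈ S} = (fun ω => (X ω, H ω)) ⁻¹' S from rfl,
      ← Measure.map_apply (hX.prodMk hH) hS, hmap, Measure.prod_apply_symm hS, hlaw,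
      lintegral_withDensity_eq_lintegral_mul _ hf.ennreal_ofReal (measurable_measure_prodMk_right hS)]
    simp only [Pi.mul_apply, hslice]
  rw [integral_eq_lintegral_of_nonneg_ae
    (Eventually.of_forall fun x => mul_nonneg (hf0 x) measureReal_nonneg)
    (hf.mul hmeas.ennreal_toReal).aestronglyMeasurable, Measure.real, h1]
  congr 1
  refine lintegral_congr fun x => ?_
  rw [ENNReal.ofReal_mul (hf0 x), Measure.real, ENNReal.ofReal_toReal (measure_ne_top _ _)]

lemma measurable_real_le (X : Ω → ℝ) : Measurable fun y => P.real {ω | X ω ≤ y} :=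
  Monotone.measurable fun _ _ hst => measureReal_mono fun _ hω => le_trans hω hst

/-- If `P(X ≤ y) ~ c y^a` and `H` has a density that is `~ d x^(2b-1)` at the origin, then
`P(X + H² ≤ y) ~ c d ∫₀¹ u^(2b-1) (1 - u²)^a du y^(a+b)`. -/
lemma tendsto_real_add_sq_le_div {X H : Ω → ℝ} (hX : Measurable X) (hH : Measurable H)
    (hX0 : ∀ ω, 0 ≤ X ω) (hXH : IndepFun X H P) {a b c d : ℝ} (ha : 0 ≤ a) (hb : 0 < b)
    {ψ : ℝ → ℝ} (hψ : Measurable ψ) (hψ0 : ∀ x, 0 ≤ ψ x) (hψlim : Tendsto ψ (𝓝[>] 0) (𝓝 d))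
    (hlaw : P.map H = volume.withDensity fun x =>
      ENNReal.ofReal ((Set.Ioi (0 : ℝ)).indicator (fun x => x ^ (2 * b - 1) * ψ x) x))
    (hlim : Tendsto (fun y => P.real {ω | X ω ≤ y} / y ^ a) (𝓝[>] 0) (𝓝 c)) :
    Tendsto (fun y => P.real {ω | X ω + H ω ^ 2 ≤ y} / y ^ (a + b)) (𝓝[>] 0)
      (𝓝 (c * d * (Real.Gamma b * Real.Gamma (a + 1) / Real.Gamma (a + b + 1) / 2))) := by
  set F : ℝ → ℝ := fun y => P.real {ω | X ω ≤ y} with hF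
  have hFmeas : Measurable F := measurable_real_le X
  have hFneg : ∀ y < 0, F y = 0 := by
    intro y hy
    have : {ω | X ω ≤ y} = ∅ := by
      ext ω
      simpa using hy.trans_le (hX0 ω)
    simp [hF, this]
  set f : ℝ → ℝ := (Set.Ioi (0 : ℝ)).indicator (fun x => x ^ (2 * b - 1) * ψ x) with hf
  have hfmeas : Measurable f := by
    refine Measurable.indicator ?_ measurableSet_Ioi
    fun_prop
  have hf0 : ∀ x, 0 ≤ f x := fun x => Set.indicator_nonneg
    (fun x (hx : 0 < x) => mul_nonneg (Real.rpow_nonneg hx.le _) (hψ0 x)) x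
  -- With `y = r²` and `x = r u` the domain becomes fixed, and each factor of the integrand has a
  -- limit as `r → 0`.
  set G : ℝ → ℝ → ℝ := fun r u =>
    u ^ (2 * b - 1) * ψ (r * u) * ((1 - u ^ 2) ^ a *
      (F (r ^ 2 * (1 - u ^ 2)) / (r ^ 2 * (1 - u ^ 2)) ^ a)) with hG
  have hrepr : ∀ r, 0 < r → P.real {ω | X ω + H ω ^ 2 ≤ r ^ 2} / (r ^ 2) ^ (a + b) =
      ∫ u in Set.Ioo (0 : ℝ) 1, G r u := by
    intro r hr
    have hS : MeasurableSet {p : ℝ × ℝ | p.1 + p.2 ^ 2 ≤ r ^ 2} :=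
      measurableSet_le (by fun_prop) measurable_const
    have h2 : ∀ x, P.real {ω | (X ω, x) ∈ {p : ℝ × ℝ | p.1 + p.2 ^ 2 ≤ r ^ 2}} =
        F (r ^ 2 - x ^ 2) := by
      intro x
      simp only [hF, Set.mem_ofPred_eq, le_sub_iff_add_le]
    have h1 : P.real {ω | X ω + H ω ^ 2 ≤ r ^ 2} = ∫ x, f x * F (r ^ 2 - x ^ 2) := by
      simp only [← h2]
      exact real_mem_eq_integral_of_indepFun hX hH hXH hfmeas hf0 hlaw hS
    have h3 := Measure.integral_comp_mul_left (fun x => f x * F (r ^ 2 - x ^ 2)) r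
    rw [abs_of_pos (inv_pos.2 hr), smul_eq_mul, eq_comm, inv_mul_eq_iff_eq_mul₀ hr.ne'] at h3
    -- The integrand vanishes off `(0, 1]`, but at `u = 1` it contains `F 0`, which is nonzero if
    -- `X` has an atom at `0` (as the empty sum does). Hence `Ioc` comes first, and the endpoint is
    -- dropped as a null set.
    rw [h1, h3, ← integral_Ioc_eq_integral_Ioo, mul_div_right_comm, ← integral_const_mul,
      integral_Ioc_eq_integral_Ioo,
      ← setIntegral_eq_integral_of_forall_compl_eq_zero (s := Set.Ioc 0 1) ?_,
      integral_Ioc_eq_integral_Ioo]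
    · refine setIntegral_congr_fun measurableSet_Ioo fun u hu => ?_
      have hu0 : 0 < u := hu.1
      have hu1 : 0 < 1 - u ^ 2 := by nlinarith [hu.2]
      have hp : (1 - u ^ 2) ^ a ≠ 0 := (Real.rpow_pos_of_pos hu1 a).ne'
      have hq : (r ^ 2) ^ a ≠ 0 := (Real.rpow_pos_of_pos (by positivity) a).ne'
      have hq' : r ^ (2 * b) ≠ 0 := (Real.rpow_pos_of_pos hr _).ne'
      have hfu : f (r * u) = (r * u) ^ (2 * b - 1) * ψ (r * u) :=
        Set.indicator_of_mem (show r * u ∈ Set.Ioi (0 : ℝ) from mul_pos hr hu0) _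
      simp only [hG]
      rw [hfu, show r ^ 2 - (r * u) ^ 2 = r ^ 2 * (1 - u ^ 2) by ring,
        Real.mul_rpow (by positivity) hu1.le, Real.mul_rpow hr.le hu0.le,
        Real.rpow_add (by positivity), Real.rpow_sub_one hr.ne',
        show (r ^ 2) ^ b = r ^ (2 * b) by rw [← Real.rpow_two, ← Real.rpow_mul hr.le]]
      field_simp
    · intro u hu
      rcases le_or_gt u 0 with h | h
      · have : f (r * u) = 0 := Set.indicator_of_notMem
          (by simpa using mul_nonpos_of_nonneg_of_nonpos hr.le h) _
        simp [this]
      · have hu1 : 1 < u := by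
          by_contra hcon
          exact hu ⟨h, not_lt.1 hcon⟩
        have : F (r ^ 2 - (r * u) ^ 2) = 0 := by
          refine hFneg _ ?_
          have : 0 < r ^ 2 * (u ^ 2 - 1) := mul_pos (by positivity) (by nlinarith)
          nlinarith
        simp [this]
  have hzero : ∀ u : ℝ, 0 < u → Tendsto (fun r : ℝ => r * u) (𝓝[>] 0) (𝓝[>] 0) := by
    intro u hu
    refine tendsto_nhdsWithin_iff.2 ⟨?_, ?_⟩
    · have h : Continuous fun r : ℝ => r * u := by fun_prop
      simpa using (h.tendsto 0).mono_left nhdsWithin_le_nhds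
    · filter_upwards [self_mem_nhdsWithin] with r hr
      exact mul_pos hr hu
  have hzero2 : Tendsto (fun r : ℝ => r ^ 2) (𝓝[>] 0) (𝓝[>] 0) := by
    refine tendsto_nhdsWithin_iff.2 ⟨?_, ?_⟩
    · have h : Continuous fun r : ℝ => r ^ 2 := by fun_prop
      simpa using (h.tendsto 0).mono_left nhdsWithin_le_nhds
    · filter_upwards [self_mem_nhdsWithin] with r hr
      exact pow_pos (show (0 : ℝ) < r from hr) 2
  -- Bounds near `0` suffice: for `u` in `(0, 1)`, `r u < r` and `r² (1 - u²) < r²`, so small `r`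
  -- makes them hold for all `u` at once.
  obtain ⟨δ, hδ, hδψ⟩ : ∃ δ > 0, ∀ x, 0 < x → x < δ → ψ x ≤ |d| + 1 := by
    have h : ∀ᶠ x in 𝓝[>] 0, ψ x ≤ |d| + 1 :=
      hψlim.eventually_le_const (lt_of_le_of_lt (le_abs_self d) (lt_add_one _))
    obtain ⟨δ, hδ, h⟩ := mem_nhdsGT_iff_exists_Ioo_subset.1 h
    exact ⟨δ, hδ, fun x hx hxδ => h ⟨hx, hxδ⟩⟩
  obtain ⟨η, hη, hηF⟩ : ∃ η > 0, ∀ y, 0 < y → y < η → F y / y ^ a ≤ |c| + 1 := by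
    have h : ∀ᶠ y in 𝓝[>] 0, F y / y ^ a ≤ |c| + 1 :=
      hlim.eventually_le_const (lt_of_le_of_lt (le_abs_self c) (lt_add_one _))
    obtain ⟨η, hη, h⟩ := mem_nhdsGT_iff_exists_Ioo_subset.1 h
    exact ⟨η, hη, fun y hy hyη => h ⟨hy, hyη⟩⟩
  have hmain : Tendsto (fun r => ∫ u in Set.Ioo (0 : ℝ) 1, G r u) (𝓝[>] 0)
      (𝓝 (∫ u in Set.Ioo (0 : ℝ) 1, c * d * (u ^ (2 * b - 1) * (1 - u ^ 2) ^ a))) := by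
    refine tendsto_integral_filter_of_dominated_convergence
      (fun u => (|d| + 1) * (|c| + 1) * u ^ (2 * b - 1)) ?_ ?_ ?_ ?_
    · refine Eventually.of_forall fun r => Measurable.aestronglyMeasurable ?_
      simp only [hG]
      fun_prop
    · have hr1 : ∀ᶠ r in 𝓝[>] (0 : ℝ), r < δ :=
        nhdsWithin_le_nhds (gt_mem_nhds hδ)
      have hr2 : ∀ᶠ r in 𝓝[>] (0 : ℝ), r ^ 2 < η :=
        (tendsto_nhdsWithin_iff.1 hzero2).1.eventually (gt_mem_nhds hη)
      filter_upwards [hr1, hr2, self_mem_nhdsWithin] with r hr1 hr2 hr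
      have hr0 : 0 < r := hr
      refine (ae_restrict_iff' measurableSet_Ioo).2 (Eventually.of_forall fun u hu => ?_)
      have hu0 : 0 < u := hu.1
      have hu1 : 0 < 1 - u ^ 2 := by nlinarith [hu.2]
      have hu2 : 1 - u ^ 2 ≤ 1 := by nlinarith
      have e1 : ψ (r * u) ≤ |d| + 1 :=
        hδψ _ (mul_pos hr0 hu0) (by nlinarith [mul_lt_mul_of_pos_left hu.2 hr0])
      have e2 := hηF (r ^ 2 * (1 - u ^ 2)) (by positivity)
        (lt_of_le_of_lt (mul_le_of_le_one_right (by positivity) hu2) hr2)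
      have e3 : (1 - u ^ 2) ^ a ≤ 1 := Real.rpow_le_one hu1.le hu2 ha
      have p1 : 0 ≤ u ^ (2 * b - 1) := Real.rpow_nonneg hu0.le _
      have p2 : 0 ≤ (1 - u ^ 2) ^ a := Real.rpow_nonneg hu1.le _
      have p3 : 0 ≤ F (r ^ 2 * (1 - u ^ 2)) / (r ^ 2 * (1 - u ^ 2)) ^ a :=
        div_nonneg measureReal_nonneg (Real.rpow_nonneg (by positivity) _)
      have p4 := hψ0 (r * u)
      simp only [hG]
      rw [Real.norm_of_nonneg (by positivity)]
      calc u ^ (2 * b - 1) * ψ (r * u) * ((1 - u ^ 2) ^ a *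
            (F (r ^ 2 * (1 - u ^ 2)) / (r ^ 2 * (1 - u ^ 2)) ^ a))
          ≤ u ^ (2 * b - 1) * (|d| + 1) * (1 * (|c| + 1)) := by gcongr
        _ = (|d| + 1) * (|c| + 1) * u ^ (2 * b - 1) := by ring
    · refine Integrable.const_mul ?_ _
      have h := intervalIntegral.intervalIntegrable_rpow' (a := 0) (b := 1) (r := 2 * b - 1)
        (by linarith)
      exact ((intervalIntegrable_iff_integrableOn_Ioc_of_le zero_le_one).1 h).mono_set
        Set.Ioo_subset_Ioc_self
    · refine (ae_restrict_iff' measurableSet_Ioo).2 (Eventually.of_forall fun u hu => ?_)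
      have hu1 : 0 < 1 - u ^ 2 := by nlinarith [hu.1, hu.2]
      have t1 := hψlim.comp (hzero u hu.1)
      have t2 := hlim.comp ((hzero _ hu1).comp hzero2)
      have t3 := (t1.const_mul (u ^ (2 * b - 1))).mul (t2.const_mul ((1 - u ^ 2) ^ a))
      rw [show c * d * (u ^ (2 * b - 1) * (1 - u ^ 2) ^ a) =
        u ^ (2 * b - 1) * d * ((1 - u ^ 2) ^ a * c) by ring]
      exact t3
  rw [integral_const_mul, integral_rpow_mul_one_sub_sq_rpow ha hb] at hmain
  have hsqrt : Tendsto Real.sqrt (𝓝[>] 0) (𝓝[>] 0) := by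
    refine tendsto_nhdsWithin_iff.2 ⟨?_, ?_⟩
    · simpa using (Real.continuous_sqrt.tendsto 0).mono_left nhdsWithin_le_nhds
    · filter_upwards [self_mem_nhdsWithin] with y hy
      exact Real.sqrt_pos.2 hy
  refine (hmain.comp hsqrt).congr' ?_
  filter_upwards [self_mem_nhdsWithin] with y hy
  have hy0 : 0 < y := hy
  have h := hrepr (Real.sqrt y) (Real.sqrt_pos.2 hy0)
  rw [Real.sq_sqrt hy0.le] at h
  exact h.symm

/-- The distribution function at the origin of a sum of squares of independent `κ-μ` variables. -/
lemma tendsto_real_sum_sq_le_div {ι : Type*} {h : ι → Ω → ℝ} {μ κ : ℝ} (hμ : 0 < μ) (hκ : 0 < κ)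
    (hmeas : ∀ l, Measurable (h l))
    (hlaw : ∀ l, P.map (h l) =
      volume.withDensity fun x => ENNReal.ofReal (kappaMuPDF μ κ x))
    (hindep : iIndepFun h P) (s : Finset ι) :
    Tendsto (fun y => P.real {ω | ∑ l ∈ s, h l ω ^ 2 ≤ y} / y ^ ((s.card : ℝ) * μ)) (𝓝[>] 0)
      (𝓝 ((kmB μ κ ^ μ * Real.exp (-(μ * κ))) ^ s.card / Real.Gamma (s.card * μ + 1))) := by
  classical
  have hpos : ∀ n : ℕ, 0 ≤ (n : ℝ) * μ := fun n => by positivity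
  induction s using Finset.induction_on with
  | empty =>
    refine Tendsto.congr' ?_ tendsto_const_nhds
    filter_upwards [self_mem_nhdsWithin] with y hy
    have hy0 : 0 ≤ y := le_of_lt hy
    simp [hy0]
  | insert i s hi ih =>
    have hind : IndepFun (fun ω => ∑ l ∈ s, h l ω ^ 2) (h i) P := by
      have h1 := hindep.indepFun_finset s {i} (by simpa using hi) hmeas
      have hproj : Measurable fun v : ({i} : Finset ι) → ℝ => v ⟨i, Finset.mem_singleton_self i⟩ :=
        measurable_pi_apply _
      have h2 := h1.comp (φ := fun v : s → ℝ => ∑ l, v l ^ 2) (by fun_prop) hproj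
      have h3 : (fun ω => ∑ l ∈ s, h l ω ^ 2) =
          (fun v : s → ℝ => ∑ l, v l ^ 2) ∘ fun ω (l : s) => h l ω := by
        funext ω
        exact (Finset.sum_coe_sort s fun l => h l ω ^ 2).symm
      rw [h3]
      exact h2
    have hl := hlaw i
    rw [kappaMuPDF_eq hμ hκ] at hl
    have hstep := tendsto_real_add_sq_le_div (by fun_prop) (hmeas i)
      (fun ω => Finset.sum_nonneg fun l _ => sq_nonneg (h l ω)) hind (hpos s.card) hμ
      (measurable_kappaMuFactor hμ) (kappaMuFactor_nonneg hμ hκ) (tendsto_kappaMuFactor hμ) hl ih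
    have hg1 := (Real.Gamma_pos_of_pos hμ).ne'
    have hg2 := (Real.Gamma_pos_of_pos (show 0 < (s.card : ℝ) * μ + 1 by
      linarith [hpos s.card])).ne'
    rw [Finset.card_insert_of_notMem hi]
    rw [show ((s.card + 1 : ℕ) : ℝ) * μ = s.card * μ + μ by push_cast; ring, pow_succ]
    simp only [Finset.sum_insert hi, add_comm (h i _ ^ 2)]
    -- The beta value's `Γ(μ)` and `Γ(nμ + 1)`, with `n = s.card`, cancel against the density limit
    -- and the inductive constant; only `Γ((n + 1)μ + 1)` remains.
    convert hstep using 2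
    field_simp

/-! ### The random waypoint distance -/

lemma rwpβ_nonneg (i : Fin 3) : 0 ≤ rwpβ i := by
  unfold rwpβ
  fin_cases i <;> simp

/-- The middle coefficient is negative, so positivity is read off a factorization, using `1190 = 35
(21 + 13)`. -/
lemma rwpPDF_nonneg {D : ℝ} (hD : 0 < D) (x : ℝ) : 0 ≤ rwpPDF D x := by
  refine Set.indicator_nonneg (fun x hx => ?_) x
  have h : ∑ i, rwpC i / D ^ (rwpβ i + 1) * x ^ rwpβ i =
      35 * x ^ 2 * (D ^ 2 - x ^ 2) * (21 * D ^ 2 - 13 * x ^ 2) / (72 * D ^ 7) := by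
    have e1 : D ^ ((2 : ℝ) + 1) = D ^ 3 := by rw [← Real.rpow_natCast]; norm_num
    have e2 : D ^ ((4 : ℝ) + 1) = D ^ 5 := by rw [← Real.rpow_natCast]; norm_num
    have e3 : D ^ ((6 : ℝ) + 1) = D ^ 7 := by rw [← Real.rpow_natCast]; norm_num
    have f1 : x ^ (2 : ℝ) = x ^ 2 := by rw [← Real.rpow_natCast]; norm_num
    have f2 : x ^ (4 : ℝ) = x ^ 4 := by rw [← Real.rpow_natCast]; norm_num
    have f3 : x ^ (6 : ℝ) = x ^ 6 := by rw [← Real.rpow_natCast]; norm_num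
    simp only [Fin.sum_univ_three, rwpC, rwpβ, Matrix.cons_val_zero, Matrix.cons_val_one,
      Matrix.cons_val, e1, e2, e3, f1, f2, f3]
    field_simp
    ring
  rw [h]
  have hx2 : x ^ 2 ≤ D ^ 2 := pow_le_pow_left₀ hx.1 hx.2 2
  have h1 : 0 ≤ D ^ 2 - x ^ 2 := by linarith
  have h2 : 0 ≤ 21 * D ^ 2 - 13 * x ^ 2 := by nlinarith [sq_nonneg D]
  positivity

lemma measurable_rwpPDF (D : ℝ) : Measurable (rwpPDF D) := by
  refine Measurable.indicator ?_ measurableSet_Icc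
  fun_prop

lemma integrableOn_rpow_Ioc {D s : ℝ} (hD : 0 < D) (hs : 0 ≤ s) :
    IntegrableOn (fun x => x ^ s) (Set.Ioc 0 D) :=
  (intervalIntegrable_iff_integrableOn_Ioc_of_le hD.le).1
    (intervalIntegral.intervalIntegrable_rpow' (by linarith))

lemma rwpPDF_eqOn (D : ℝ) : Set.EqOn (rwpPDF D)
    (fun x => ∑ i, rwpC i / D ^ (rwpβ i + 1) * x ^ rwpβ i) (Set.Ioc 0 D) := fun _ hx =>
  Set.indicator_of_mem (Set.Ioc_subset_Icc_self hx) _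

lemma integrableOn_rwpPDF {D : ℝ} (hD : 0 < D) : IntegrableOn (rwpPDF D) (Set.Ioc 0 D) := by
  refine (integrableOn_congr_fun (rwpPDF_eqOn D) measurableSet_Ioc).2 ?_
  exact integrable_finsetSum _ fun i _ =>
    Integrable.const_mul (integrableOn_rpow_Ioc hD (rwpβ_nonneg i)) _

/-- The moments of the random waypoint distance. -/
lemma integral_rwpPDF_mul_rpow {D s : ℝ} (hD : 0 < D) (hs : 0 ≤ s) :
    ∫ x in Set.Ioc 0 D, rwpPDF D x * x ^ s = D ^ s * ∑ i, rwpC i / (rwpβ i + 1 + s) := by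
  have h : ∀ x ∈ Set.Ioc 0 D, rwpPDF D x * x ^ s =
      ∑ i, rwpC i / D ^ (rwpβ i + 1) * x ^ (rwpβ i + s) := by
    intro x hx
    rw [rwpPDF_eqOn D hx, Finset.sum_mul]
    refine Finset.sum_congr rfl fun i _ => ?_
    rw [Real.rpow_add hx.1, mul_assoc]
  rw [setIntegral_congr_fun measurableSet_Ioc h, integral_finsetSum, Finset.mul_sum]
  · refine Finset.sum_congr rfl fun i _ => ?_
    have hβ := rwpβ_nonneg i
    rw [integral_const_mul, ← intervalIntegral.integral_of_le hD.le,
      integral_rpow (Or.inl (by linarith)), Real.zero_rpow (by linarith), sub_zero,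
      show rwpβ i + s + 1 = (rwpβ i + 1) + s by ring, Real.rpow_add hD (rwpβ i + 1) s]
    have h1 := (Real.rpow_pos_of_pos hD (rwpβ i + 1)).ne'
    generalize D ^ (rwpβ i + 1) = t at h1
    field_simp
  · exact fun i _ => Integrable.const_mul
      (integrableOn_rpow_Ioc hD (add_nonneg (rwpβ_nonneg i) hs)) _

/-- Over a common denominator the `s²` terms cancel because the `C_i` sum to `0`, leaving a linear
numerator with positive coefficients. -/
lemma rwp_moment_pos {s : ℝ} (hs : 0 ≤ s) : 0 < ∑ i, rwpC i / (rwpβ i + 1 + s) := by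
  have h : ∑ i, rwpC i / (rwpβ i + 1 + s) =
      (560 * s + 7560) / (72 * ((3 + s) * (5 + s) * (7 + s))) := by
    simp only [Fin.sum_univ_three, rwpC, rwpβ, Matrix.cons_val_zero, Matrix.cons_val_one,
      Matrix.cons_val]
    have h3 : (2 : ℝ) + 1 + s ≠ 0 := by positivity
    have h5 : (4 : ℝ) + 1 + s ≠ 0 := by positivity
    have h7 : (6 : ℝ) + 1 + s ≠ 0 := by positivity
    have h3' : 3 + s ≠ 0 := by positivity
    have h5' : 5 + s ≠ 0 := by positivity
    have h7' : 7 + s ≠ 0 := by positivity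
    field_simp
    ring
  rw [h]
  positivity

/-- Given `q = x` the event is `X ≤ ε x ^ α`, of probability `~ c ε ^ a x ^ (α a)`; averaging over
`q` gives the moment of order `α a`. -/
lemma tendsto_real_mul_rpow_le_div {X q : Ω → ℝ} (hX : Measurable X) (hq : Measurable q)
    (hXq : IndepFun X q P) {a c α D : ℝ} (ha : 0 ≤ a) (hα : 0 < α) (hD : 0 < D)
    (hlaw : P.map q = volume.withDensity fun x => ENNReal.ofReal (rwpPDF D x))
    (hlim : Tendsto (fun y => P.real {ω | X ω ≤ y} / y ^ a) (𝓝[>] 0) (𝓝 c)) :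
    Tendsto (fun ε => P.real {ω | X ω * q ω ^ (-α) ≤ ε} / ε ^ a) (𝓝[>] 0)
      (𝓝 (c * (D ^ (α * a) * ∑ i, rwpC i / (rwpβ i + 1 + α * a)))) := by
  set F : ℝ → ℝ := fun y => P.real {ω | X ω ≤ y} with hF
  have hFmeas : Measurable F := measurable_real_le X
  have hfmeas := measurable_rwpPDF D
  have hrepr : ∀ ε, 0 < ε → P.real {ω | X ω * q ω ^ (-α) ≤ ε} / ε ^ a =
      ∫ x in Set.Ioc 0 D, rwpPDF D x * x ^ (α * a) * (F (ε * x ^ α) / (ε * x ^ α) ^ a) := by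
    intro ε hε
    have hS : MeasurableSet {p : ℝ × ℝ | p.1 * p.2 ^ (-α) ≤ ε} :=
      measurableSet_le (by fun_prop) measurable_const
    have h1 := real_mem_eq_integral_of_indepFun hX hq hXq hfmeas (rwpPDF_nonneg hD) hlaw hS
    have hεa : ε ^ a ≠ 0 := (Real.rpow_pos_of_pos hε a).ne'
    rw [div_eq_iff hεa, ← integral_mul_const]
    refine h1.trans ?_
    rw [← setIntegral_eq_integral_of_forall_compl_eq_zero (s := Set.Ioc 0 D) ?_]
    · refine setIntegral_congr_fun measurableSet_Ioc fun x hx => ?_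
      have hxα : 0 < x ^ α := Real.rpow_pos_of_pos hx.1 α
      have hset : {ω | (X ω, x) ∈ {p : ℝ × ℝ | p.1 * p.2 ^ (-α) ≤ ε}} =
          {ω | X ω ≤ ε * x ^ α} := by
        ext ω
        simp only [Set.mem_ofPred_eq]
        rw [Real.rpow_neg hx.1.le, ← div_eq_mul_inv, div_le_iff₀ hxα]
      have hxa : (x ^ α) ^ a ≠ 0 := (Real.rpow_pos_of_pos hxα a).ne'
      simp only [hset, hF]
      rw [Real.mul_rpow hε.le hxα.le, Real.rpow_mul hx.1.le]
      field_simp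
    · intro x hx
      have : rwpPDF D x = 0 := by
        -- The support of the density includes `0`, but all exponents are positive, so it vanishes
        -- there.
        rcases eq_or_ne x 0 with rfl | h0
        · unfold rwpPDF
          rw [Set.indicator_of_mem (Set.left_mem_Icc.2 hD.le)]
          simp [Fin.sum_univ_three, rwpβ]
        · exact Set.indicator_of_notMem
            (fun hm => hx ⟨lt_of_le_of_ne hm.1 h0.symm, hm.2⟩) _
      simp [this]
  have hzero : ∀ x : ℝ, 0 < x → Tendsto (fun ε : ℝ => ε * x ^ α) (𝓝[>] 0) (𝓝[>] 0) := by
    intro x hx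
    refine tendsto_nhdsWithin_iff.2 ⟨?_, ?_⟩
    · have h : Continuous fun ε : ℝ => ε * x ^ α := by fun_prop
      simpa using (h.tendsto 0).mono_left nhdsWithin_le_nhds
    · filter_upwards [self_mem_nhdsWithin] with ε hε
      exact mul_pos hε (Real.rpow_pos_of_pos hx α)
  obtain ⟨η, hη, hηF⟩ : ∃ η > 0, ∀ y, 0 < y → y < η → F y / y ^ a ≤ |c| + 1 := by
    have h : ∀ᶠ y in 𝓝[>] 0, F y / y ^ a ≤ |c| + 1 :=
      hlim.eventually_le_const (lt_of_le_of_lt (le_abs_self c) (lt_add_one _))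
    obtain ⟨η, hη, h⟩ := mem_nhdsGT_iff_exists_Ioo_subset.1 h
    exact ⟨η, hη, fun y hy hyη => h ⟨hy, hyη⟩⟩
  have hmain : Tendsto (fun ε => ∫ x in Set.Ioc 0 D,
      rwpPDF D x * x ^ (α * a) * (F (ε * x ^ α) / (ε * x ^ α) ^ a)) (𝓝[>] 0)
      (𝓝 (∫ x in Set.Ioc 0 D, rwpPDF D x * x ^ (α * a) * c)) := by
    refine tendsto_integral_filter_of_dominated_convergence
      (fun x => rwpPDF D x * (D ^ (α * a) * (|c| + 1))) ?_ ?_ ?_ ?_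
    · exact Eventually.of_forall fun ε => Measurable.aestronglyMeasurable (by fun_prop)
    · have hε1 : ∀ᶠ ε in 𝓝[>] (0 : ℝ), ε * D ^ α < η :=
        (tendsto_nhdsWithin_iff.1 (hzero D hD)).1.eventually (gt_mem_nhds hη)
      filter_upwards [hε1, self_mem_nhdsWithin] with ε hε1 hε
      have hε0 : 0 < ε := hε
      refine (ae_restrict_iff' measurableSet_Ioc).2 (Eventually.of_forall fun x hx => ?_)
      have hx0 : 0 < x := hx.1
      have hxα : 0 < x ^ α := Real.rpow_pos_of_pos hx0 α
      have e1 : x ^ (α * a) ≤ D ^ (α * a) := Real.rpow_le_rpow hx0.le hx.2 (by positivity)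
      have e2 := hηF (ε * x ^ α) (by positivity) (lt_of_le_of_lt (by
        have := Real.rpow_le_rpow hx0.le hx.2 hα.le
        gcongr) hε1)
      have p1 := rwpPDF_nonneg hD x
      have p2 : 0 ≤ F (ε * x ^ α) / (ε * x ^ α) ^ a :=
        div_nonneg measureReal_nonneg (Real.rpow_nonneg (by positivity) _)
      rw [Real.norm_of_nonneg (by positivity), mul_assoc]
      gcongr
    · exact (integrableOn_rwpPDF hD).mul_const _
    · refine (ae_restrict_iff' measurableSet_Ioc).2 (Eventually.of_forall fun x hx => ?_)
      exact (hlim.comp (hzero x hx.1)).const_mul _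
  rw [integral_mul_const, integral_rwpPDF_mul_rpow hD (by positivity), mul_comm _ c] at hmain
  refine hmain.congr' ?_
  filter_upwards [self_mem_nhdsWithin] with ε hε
  exact (hrepr ε hε).symm

/-! ### Comparison of the leading coefficients -/

/-- The coefficient of the lowest power `(K₂ γ) ^ (Lμ)` in the asymptotic CDF. -/
noncomputable def leadingCoeff (α μ κ : ℝ) (L p : ℕ) : ℝ :=
  ∑ i : Fin 3, K₁ α μ κ L p i 0 * gammaRatio α μ L i 0

/-- At `k = 0`, `p Γ(p) = Γ(p + 1)` removes `p` from `V`, so the truncation order does not affect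
the leading term. The factor `1 / α` of `K₁` is absorbed by `Ψ_i + Lμ = (β_i + 1 + αLμ) / α`. -/
lemma leadingCoeff_eq {α μ κ : ℝ} {L p : ℕ} (hα : 0 < α) (hμ : 0 < μ) (hL : 1 ≤ L)
    (hp : 1 ≤ p) :
    leadingCoeff α μ κ L p = Real.exp (-(L * μ * κ)) / Real.Gamma (L * μ + 1) *
      ∑ i, rwpC i / (rwpβ i + 1 + α * (L * μ)) := by
  have hL' : (0 : ℝ) < L := by exact_mod_cast hL
  have hp' : (0 : ℝ) < p := by exact_mod_cast hp
  have hLμ : 0 < (L : ℝ) * μ := by positivity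
  rw [leadingCoeff, Finset.mul_sum]
  refine Finset.sum_congr rfl fun i _ => ?_
  have hβ := rwpβ_nonneg i
  rw [gammaRatio_eq hα hμ hL, K₁, V, Ψ, Real.Gamma_add_one hLμ.ne', Real.exp_neg]
  simp only [Nat.cast_zero, add_zero, sub_zero, zero_add, mul_zero, pow_zero, mul_one,
    sub_add_cancel, Real.Gamma_one, one_mul, zpow_one]
  rw [Real.Gamma_add_one hp'.ne']
  have g1 := (Real.Gamma_pos_of_pos hp').ne'
  have g2 := (Real.Gamma_pos_of_pos hLμ).ne'
  have h1 : rwpβ i + 1 + α * (L * μ) ≠ 0 := by positivity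
  have h2 : (L : ℝ) * μ + 1 / α * (rwpβ i + 1) ≠ 0 := by positivity
  rw [show (L : ℝ) * μ + 1 / α * (rwpβ i + 1) = (rwpβ i + 1 + α * (L * μ)) / α by
    field_simp; ring]
  field_simp

lemma leadingCoeff_pos {α μ κ : ℝ} {L p : ℕ} (hα : 0 < α) (hμ : 0 < μ) (hL : 1 ≤ L)
    (hp : 1 ≤ p) : 0 < leadingCoeff α μ κ L p := by
  rw [leadingCoeff_eq hα hμ hL hp]
  have h := rwp_moment_pos (s := α * (L * μ)) (by positivity)
  have hg : 0 < Real.Gamma ((L : ℝ) * μ + 1) := Real.Gamma_pos_of_pos (by positivity)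
  positivity

lemma tendsto_K₂_mul {ρ α D μ κ γ : ℝ} {L : ℕ} (hρ : 0 < ρ) (hD : 0 < D) (hμ : 0 < μ)
    (hκ : 0 < κ) (hL : 1 ≤ L) (hγ : 0 < γ) :
    Tendsto (fun γbar => K₂ ρ α D μ κ L γbar * γ) atTop (𝓝[>] 0) := by
  have hL' : (0 : ℝ) < L := by exact_mod_cast hL
  have hDα := Real.rpow_pos_of_pos hD α
  have hB : 0 < kmB (L * μ) κ := by unfold kmB; positivity
  refine tendsto_nhdsWithin_iff.2 ⟨?_, ?_⟩
  · have h : Tendsto (fun γbar => K₂ ρ α D μ κ L γbar) atTop (𝓝 0) :=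
      (tendsto_id.const_mul_atTop (show 0 < ρ * L by positivity)).const_div_atTop _
    simpa using h.mul_const γ
  · filter_upwards [eventually_gt_atTop 0] with γbar hγbar
    unfold K₂
    exact Set.mem_Ioi.2 (by positivity)

lemma rpow_add_natCast_div {z b : ℝ} (hz : 0 < z) (k : ℕ) : z ^ (b + k) / z ^ b = z ^ k := by
  rw [Real.rpow_add hz, mul_div_cancel_left₀ _ (Real.rpow_pos_of_pos hz b).ne', Real.rpow_natCast]

/-- A finite sum of terms `c * G z` with `G z / z ^ (b + k)` convergent is dominated by `k = 0`. -/
lemma tendsto_sum_div_rpow {p : ℕ} {b : ℝ} {G : Fin 3 → ℕ → ℝ → ℂ} {c g : Fin 3 → ℕ → ℂ}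
    (hG : ∀ i k, Tendsto (fun z : ℝ => G i k z / ((z ^ (b + k) : ℝ) : ℂ)) (𝓝[>] 0)
      (𝓝 (g i k))) :
    Tendsto (fun z : ℝ => (∑ i, ∑ k ∈ Finset.range (p + 1), c i k * G i k z) /
      ((z ^ b : ℝ) : ℂ)) (𝓝[>] 0) (𝓝 (∑ i, c i 0 * g i 0)) := by
  have hk : ∀ k : ℕ, Tendsto (fun z : ℝ => ((z ^ k : ℝ) : ℂ)) (𝓝[>] 0)
      (𝓝 (((0 : ℝ) ^ k : ℝ) : ℂ)) := fun k => by
    have h : Continuous fun z : ℝ => ((z ^ k : ℝ) : ℂ) := by fun_prop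
    exact (h.tendsto 0).mono_left nhdsWithin_le_nhds
  have h := tendsto_finsetSum Finset.univ fun (i : Fin 3) _ =>
    tendsto_finsetSum (Finset.range (p + 1)) fun k _ =>
      (((hG i k).const_mul (c i k)).mul (hk k))
  have hlim : ∑ i, ∑ k ∈ Finset.range (p + 1), c i k * g i k * (((0 : ℝ) ^ k : ℝ) : ℂ) =
      ∑ i, c i 0 * g i 0 := by
    refine Finset.sum_congr rfl fun i _ => ?_
    rw [Finset.sum_eq_single_of_mem 0 (by simp) fun k _ hk => by simp [hk]]
    simp
  rw [hlim] at h
  refine h.congr' ?_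
  filter_upwards [self_mem_nhdsWithin] with z hz
  have hz0 : 0 < z := hz
  have h1 : ((z ^ b : ℝ) : ℂ) ≠ 0 := by exact_mod_cast (Real.rpow_pos_of_pos hz0 b).ne'
  simp only [Finset.sum_div]
  refine Finset.sum_congr rfl fun i _ => Finset.sum_congr rfl fun k _ => ?_
  have h2 : ((z ^ (b + k) : ℝ) : ℂ) ≠ 0 := by
    exact_mod_cast (Real.rpow_pos_of_pos hz0 (b + k)).ne'
  rw [← rpow_add_natCast_div (b := b) hz0 k, Complex.ofReal_div]
  field_simp

lemma isEquivalent_of_tendsto_div {𝕜 : Type*} [NormedField 𝕜] {u v w : ℝ → 𝕜} {c : 𝕜}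
    (hc : c ≠ 0) (hw : ∀ᶠ x in atTop, w x ≠ 0)
    (hu : Tendsto (fun x => u x / w x) atTop (𝓝 c))
    (hv : Tendsto (fun x => v x / w x) atTop (𝓝 c)) : u ~[atTop] v := by
  have hv0 : ∀ᶠ x in atTop, v x ≠ 0 := by
    filter_upwards [hv.eventually_ne hc] with x hx h0
    simp [h0] at hx
  refine (isEquivalent_iff_tendsto_one hv0).2 ?_
  have h := hu.div hv hc
  rw [div_self hc] at h
  refine h.congr' ?_
  filter_upwards [hw] with x hx
  simp only [Pi.div_apply]
  rw [div_div_div_cancel_right₀ hx]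

/-! ### Limits of the ratios to the common power `(K₂ γ) ^ (Lμ)` -/

section Asymptotics

variable {ρ α D μ κ γ : ℝ} {L p : ℕ}

lemma tendsto_cdfG_div (hρ : 0 < ρ) (hα : 0 < α) (hD : 0 < D) (hμ : 0 < μ) (hκ : 0 < κ)
    (hL : 1 ≤ L) (hγ : 0 < γ) :
    Tendsto (fun γbar => cdfG ρ α D μ κ L p γbar γ /
      (((K₂ ρ α D μ κ L γbar * γ) ^ ((L : ℝ) * μ) : ℝ) : ℂ)) atTop
      (𝓝 (leadingCoeff α μ κ L p : ℂ)) := by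
  have h := (tendsto_sum_div_rpow (p := p) (c := fun i k => (K₁ α μ κ L p i k : ℂ))
    fun i k => tendsto_termG_div hα hμ hL i k).comp (tendsto_K₂_mul (α := α) hρ hD hμ hκ hL hγ)
  rw [leadingCoeff]
  push_cast
  exact h

/-- The same complex summation lemma applies, with each Meijer function replaced by its exact power
term; real parts are then taken. -/
lemma tendsto_cdfInf_div (hρ : 0 < ρ) (hD : 0 < D) (hμ : 0 < μ) (hκ : 0 < κ)
    (hL : 1 ≤ L) (hγ : 0 < γ) :
    Tendsto (fun γbar => cdfInf ρ α D μ κ L p γbar γ /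
      (K₂ ρ α D μ κ L γbar * γ) ^ ((L : ℝ) * μ)) atTop (𝓝 (leadingCoeff α μ κ L p)) := by
  have hG : ∀ (i : Fin 3) (k : ℕ), Tendsto (fun z : ℝ =>
      ((z ^ ((L : ℝ) * μ + k) * gammaRatio α μ L i k : ℝ) : ℂ) /
        ((z ^ ((L : ℝ) * μ + k) : ℝ) : ℂ)) (𝓝[>] 0) (𝓝 (gammaRatio α μ L i k : ℂ)) := by
    intro i k
    refine Tendsto.congr' ?_ tendsto_const_nhds
    filter_upwards [self_mem_nhdsWithin] with z hz
    rw [← Complex.ofReal_div, mul_div_cancel_left₀ _ (Real.rpow_pos_of_pos hz _).ne']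
  have h := (tendsto_sum_div_rpow (p := p) (c := fun i k => (K₁ α μ κ L p i k : ℂ)) hG).comp
    (tendsto_K₂_mul (α := α) hρ hD hμ hκ hL hγ)
  have h2 := (Complex.continuous_re.tendsto _).comp h
  have e1 : (∑ i, (K₁ α μ κ L p i 0 : ℂ) * (gammaRatio α μ L i 0 : ℂ)).re =
      leadingCoeff α μ κ L p := by
    rw [leadingCoeff]
    simp
  rw [e1] at h2
  refine h2.congr fun γbar => ?_
  simp only [Function.comp, ← Complex.ofReal_mul, ← Complex.ofReal_sum, ← Complex.ofReal_div,
    Complex.ofReal_re, cdfInf, mul_assoc]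

variable {h : Fin L → Ω → ℝ} {q : Ω → ℝ}

lemma tendsto_cdf_snr_div (hρ : 0 < ρ) (hα : 0 < α) (hD : 0 < D) (hμ : 0 < μ) (hκ : 0 < κ)
    (hL : 1 ≤ L) (hp : 1 ≤ p) (hγ : 0 < γ)
    (hh_meas : ∀ l, Measurable (h l)) (hq_meas : Measurable q)
    (hh_law : ∀ l, P.map (h l) =
      volume.withDensity fun x => ENNReal.ofReal (kappaMuPDF μ κ x))
    (hq_law : P.map q = volume.withDensity fun x => ENNReal.ofReal (rwpPDF D x))
    (hh_indep : iIndepFun h P) (hhq_indep : IndepFun (fun ω l => h l ω) q P) :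
    Tendsto (fun γbar => cdf (P.map (snr ρ α h q γbar)) γ /
      (K₂ ρ α D μ κ L γbar * γ) ^ ((L : ℝ) * μ)) atTop (𝓝 (leadingCoeff α μ κ L p)) := by
  have hL' : (0 : ℝ) < L := by exact_mod_cast hL
  have hLμ : 0 < (L : ℝ) * μ := by positivity
  have hB : 0 < kmB μ κ := by unfold kmB; positivity
  have hDα := Real.rpow_pos_of_pos hD α
  set X : Ω → ℝ := fun ω => ∑ l, h l ω ^ 2 with hX
  have hXmeas : Measurable X := by fun_prop
  have hXq : IndepFun X q P :=
    hhq_indep.comp (φ := fun v : Fin L → ℝ => ∑ l, v l ^ 2) (by fun_prop) measurable_id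
  have hlim := tendsto_real_sum_sq_le_div hμ hκ hh_meas hh_law hh_indep Finset.univ
  rw [Finset.card_univ, Fintype.card_fin] at hlim
  have hmain := tendsto_real_mul_rpow_le_div hXmeas hq_meas hXq hLμ.le hα hD hq_law hlim
  have hε : Tendsto (fun γbar : ℝ => γ / (ρ * γbar)) atTop (𝓝[>] 0) := by
    refine tendsto_nhdsWithin_iff.2 ⟨?_, ?_⟩
    · exact (tendsto_id.const_mul_atTop hρ).const_div_atTop _
    · filter_upwards [eventually_gt_atTop 0] with γbar hγbar
      exact Set.mem_Ioi.2 (by positivity)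
  have hfin := (hmain.comp hε).div_const ((kmB μ κ * D ^ α) ^ ((L : ℝ) * μ))
  have hval : (kmB μ κ ^ μ * Real.exp (-(μ * κ))) ^ L / Real.Gamma (L * μ + 1) *
      (D ^ (α * (L * μ)) * ∑ i, rwpC i / (rwpβ i + 1 + α * (L * μ))) /
        (kmB μ κ * D ^ α) ^ ((L : ℝ) * μ) = leadingCoeff α μ κ L p := by
    have h1 : (kmB μ κ ^ μ) ^ L = kmB μ κ ^ ((L : ℝ) * μ) := by
      rw [mul_comm, Real.rpow_mul hB.le, Real.rpow_natCast]
    have h2 : Real.exp (-(μ * κ)) ^ L = Real.exp (-(L * μ * κ)) := by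
      rw [← Real.exp_nat_mul]
      congr 1
      ring
    rw [leadingCoeff_eq hα hμ hL hp, mul_pow, h1, h2, Real.mul_rpow hB.le hDα.le,
      Real.rpow_mul hD.le]
    have n1 := (Real.rpow_pos_of_pos hB ((L : ℝ) * μ)).ne'
    have n2 := (Real.rpow_pos_of_pos hDα ((L : ℝ) * μ)).ne'
    field_simp
  rw [hval] at hfin
  refine hfin.congr' ?_
  filter_upwards [eventually_gt_atTop 0] with γbar hγbar
  have hsnr : Measurable (snr ρ α h q γbar) := by
    unfold snr
    fun_prop
  have : IsProbabilityMeasure (P.map (snr ρ α h q γbar)) :=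
    Measure.isProbabilityMeasure_map hsnr.aemeasurable
  have hset : snr ρ α h q γbar ⁻¹' Set.Iic γ = {ω | X ω * q ω ^ (-α) ≤ γ / (ρ * γbar)} := by
    ext ω
    have e : snr ρ α h q γbar ω = X ω * q ω ^ (-α) * (ρ * γbar) := by
      simp only [snr, hX, Finset.sum_mul, sq_abs]
      exact Finset.sum_congr rfl fun l _ => by ring
    simp only [Set.mem_preimage, Set.mem_Iic, Set.mem_ofPred_eq]
    rw [e, le_div_iff₀ (by positivity)]
  -- The `L` in the denominator of `K₂` cancels the `L` in `kmB (L * μ) κ`, so `K₂ γ` is the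
  -- threshold `ε = γ / (ϱ γbar)` up to the constant `B D ^ α` of one branch.
  have hK : K₂ ρ α D μ κ L γbar * γ = γ / (ρ * γbar) * (kmB μ κ * D ^ α) := by
    unfold K₂ kmB
    field_simp
  simp only [Function.comp]
  rw [cdf_eq_real, map_measureReal_apply hsnr measurableSet_Iic, hset, hK,
    Real.mul_rpow (x := γ / (ρ * γbar)) (by positivity) (by positivity), div_div]

end Asymptotics

end RFLink

theorem lemma3 {Ω : Type*} [MeasurableSpace Ω] (P : Measure Ω) [IsProbabilityMeasure P]
    (L p : ℕ) (hL : 1 ≤ L) (hp : 1 ≤ p)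
    (ρ α D μ κ : ℝ) (hρ : 0 < ρ) (hα : 0 < α) (hD : 0 < D) (hμ : 0 < μ) (hκ : 0 < κ)
    (h : Fin L → Ω → ℝ) (q : Ω → ℝ)
    (hh_meas : ∀ l, Measurable (h l)) (hq_meas : Measurable q)
    (hh_law : ∀ l, P.map (h l) =
      volume.withDensity fun x => ENNReal.ofReal (RFLink.kappaMuPDF μ κ x))
    (hq_law : P.map q = volume.withDensity fun x => ENNReal.ofReal (RFLink.rwpPDF D x))
    (hh_indep : iIndepFun h P)
    (hhq_indep : IndepFun (fun ω l => h l ω) q P) :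
    -- the CDF of the SNR is asymptotically equivalent to `cdfInf` at high average SNR
    (∀ γ : ℝ, 0 < γ →
      (fun γbar : ℝ => cdf (P.map (RFLink.snr ρ α h q γbar)) γ) ~[atTop]
        fun γbar : ℝ => RFLink.cdfInf ρ α D μ κ L p γbar γ) ∧
    -- so is its Meijer G expression
    (∀ γ : ℝ, 0 < γ →
      (fun γbar : ℝ => RFLink.cdfG ρ α D μ κ L p γbar γ) ~[atTop]
        fun γbar : ℝ => (RFLink.cdfInf ρ α D μ κ L p γbar γ : ℂ)) ∧
    -- and each power term of `cdfInf` is the leading term of its Meijer G-function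
    (∀ (i : Fin 3) (k : ℕ), k ≤ p →
      (fun z : ℝ => RFLink.termG α μ L i k z) ~[𝓝[>] 0]
        fun z : ℝ => ((z ^ (L * μ + k) * RFLink.gammaRatio α μ L i k : ℝ) : ℂ)) := by
  have hc : RFLink.leadingCoeff α μ κ L p ≠ 0 := (RFLink.leadingCoeff_pos hα hμ hL hp).ne'
  have hw : ∀ γ : ℝ, 0 < γ → ∀ᶠ γbar in atTop,
      (RFLink.K₂ ρ α D μ κ L γbar * γ) ^ ((L : ℝ) * μ) ≠ 0 := fun γ hγ => by
    filter_upwards [(tendsto_nhdsWithin_iff.1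
      (RFLink.tendsto_K₂_mul (α := α) hρ hD hμ hκ hL hγ)).2] with γbar hpos
    exact (Real.rpow_pos_of_pos hpos _).ne'
  refine ⟨fun γ hγ => ?_, fun γ hγ => ?_, fun i k _ => RFLink.termG_isEquivalent hα hμ hL i k⟩
  · exact RFLink.isEquivalent_of_tendsto_div hc (hw γ hγ)
      (RFLink.tendsto_cdf_snr_div hρ hα hD hμ hκ hL hp hγ hh_meas hq_meas hh_law hq_law
        hh_indep hhq_indep)
      (RFLink.tendsto_cdfInf_div hρ hD hμ hκ hL hγ)
  · refine RFLink.isEquivalent_of_tendsto_div (Complex.ofReal_ne_zero.2 hc)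
      ((hw γ hγ).mono fun _ hx => Complex.ofReal_ne_zero.2 hx)
      (RFLink.tendsto_cdfG_div hρ hα hD hμ hκ hL hγ) ?_
    refine ((Complex.continuous_ofReal.tendsto _).comp
      (RFLink.tendsto_cdfInf_div hρ hD hμ hκ hL hγ)).congr fun γbar => ?_
    simp only [Function.comp, Complex.ofReal_div]
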